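/- Let $\pi\colon E\to\mathbb R$ be a smooth fibre bundle with $\dim E=n+1$ and bundle coordinates $(t,q^A)$, $A=1,\dots,n$. Let $J^1\pi$ be its first jet space, identified with the affine subbundle $\{v\in TE : \langle dt,v\rangle=1\}$ of $TE$ by the natural embedding $j$, with coordinates $(t,q^A,\dot q^A)$ and projections $\pi_{1,0}\colon J^1\pi\to E$, $\pi_1=\pi\circ\pi_{1,0}$. Let $L\in C^\infty(J^1\pi)$ be a regular Lagrangian, i.e. the matrix $\bigl(\partial^2L/\partial\dot q^A\partial\dot q^B\bigr)$ is non-singular everywhere. Put $\tilde\eta=\pi_1^*dt$, let $\tilde S=(dq^A-\dot q^A dt)\otimes\partial/\partial\dot q^A$ be the vertical endomorphism, and let $\Theta_L=L\,\tilde\eta+\tilde S^*(dL)$ and $\omega_L=-d\Theta_L$ be the Poincaré–Cartan forms. The extended Legendre map $\mathrm{Leg}_L\colon J^1\pi\to T^*E$ is defined by $\mathrm{Leg}_L(v)(w)=\Theta_L(\tilde w)$ for any $\tilde w\in T_vJ^1\pi$ with $(\pi_{1,0})_*\tilde w=w$; in coordinates $\tau=L-\dot q^A\,\partial L/\partial\dot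 q^A$, $p_A=\partial L/\partial\dot q^A$. On the fibred product $T^*E\times_E J^1\pi$, with projections $pr_1,pr_2$ onto the factors and $pr$ onto $E$, put $$\eta=(\pi\circ pr)^*dt,\qquad \mathcal H=\langle pr_1,\,j\circ pr_2\rangle-pr_2^*L,\qquad \omega_{\mathcal H}=pr_1^*\omega_E+d\mathcal H\wedge\eta ,$$ where $\omega_E=dq^A\wedge dp_A+dt\wedge d\tau$ is the canonical symplectic form of $T^*E$. Let $\mathrm{graph}_L$ be the image of the map $\mathrm{Leg}_L\times_E \mathrm{id}\colon J^1\pi\to T^*E\times_EJ^1\pi$. Then: (i) there is exactly one vector field $X_L$ on $J^1\pi$ with $i_{X_L}\omega_L=0$ and $i_{X_L}\tilde\eta=1$ (the Euler–Lagrange vector field), and it is smooth; (ii) there is exactly one vector field $Z$ on $T^*E\times_EJ^1\pi$ defined along $\mathrm{graph}_L$ and tangent to $\mathrm{graph}_L$ that satisfies $i_Z\omega_{\mathcal H}=0$ and $i_Z\eta=1$ at all points of $\mathrm{graph}_L$, and it is smooth; (iii) $Z$ is $(\mathrm{Leg}_L\times_E\mathrm{id})$-related to $X_L$: for every $x\in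 J^1\pi$, $(\mathrm{Leg}_L\times_E \mathrm{id})_*(X_L)_x=Z_{\bar x}$ with $\bar x=(\mathrm{Leg}_L\times_E\mathrm{id})(x)$. -/

import Mathlib

open Set Topology
open scoped Manifold ContDiff

noncomputable section
namespace SkinnerRusk
universe u

/-- Model space of the fibres, with coordinates `q^1, …, q^n`. -/
abbrev Fib (n : ℕ) : Type := EuclideanSpace ℝ (Fin n)
/-- Model space of the total space `E`, with coordinates `(t, q)`; `dim E = n + 1`. -/
abbrev EMod (n : ℕ) : Type := ℝ × Fib n

section
variable {n : ℕ} {E : Type u} [TopologicalSpace E] [ChartedSpace (EMod n) E]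

/-- `π : E → ℝ` is a smooth locally trivial fibre bundle whose typical fibre is a smooth
`n`-dimensional manifold. (The typical fibre is diffeomorphic to any fibre of `π`, hence may be taken
in the universe of `E`.) -/
class IsFibreBundle (n : ℕ) {E : Type u} [TopologicalSpace E] [ChartedSpace (EMod n) E]
    (π : E → ℝ) : Prop where
  exists_trivialization : ∃ (Q : Type u) (_ : TopologicalSpace Q) (_ : ChartedSpace (Fib n) Q)
    (_ : IsManifold 𝓘(ℝ, Fib n) ∞ Q), ∀ t : ℝ, ∃ e : Bundle.Trivialization Q π, t ∈ e.baseSet ∧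
      ContMDiffOn 𝓘(ℝ, EMod n) (𝓘(ℝ, ℝ).prod 𝓘(ℝ, Fib n)) ∞ e e.source ∧
      ContMDiffOn (𝓘(ℝ, ℝ).prod 𝓘(ℝ, Fib n)) 𝓘(ℝ, EMod n) ∞ e.toOpenPartialHomeomorph.symm e.target

/-- Bundle charts `(t, q^A)` of `E`: local diffeomorphisms onto open subsets of `ℝ × ℝⁿ` whose first
coordinate is `π`. -/
structure IsBundleChart (π : E → ℝ) (φ : OpenPartialHomeomorph E (EMod n)) : Prop where
  smooth : ContMDiffOn 𝓘(ℝ, EMod n) 𝓘(ℝ, EMod n) ∞ φ φ.source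
  smooth_symm : ContMDiffOn 𝓘(ℝ, EMod n) 𝓘(ℝ, EMod n) ∞ φ.symm φ.target
  fst_eq : ∀ x ∈ φ.source, (φ x).1 = π x

/-- The differential of `φ` at `x`. -/
def toMod (φ : OpenPartialHomeomorph E (EMod n)) (x : E) :
    TangentSpace 𝓘(ℝ, EMod n) x →L[ℝ] EMod n :=
  mvfderiv 𝓘(ℝ, EMod n) φ x

/-- The differential of `φ⁻¹` at `y`. -/
def fromMod (φ : OpenPartialHomeomorph E (EMod n)) (y : EMod n) :
    EMod n →L[ℝ] TangentSpace 𝓘(ℝ, EMod n) (φ.symm y) :=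
  mfderiv 𝓘(ℝ, EMod n) 𝓘(ℝ, EMod n) φ.symm y

/-- Bundle charts cover `E`. -/
theorem exists_bundleChart (π : E → ℝ) [h : IsFibreBundle n π] (x : E) :
    ∃ φ : OpenPartialHomeomorph E (EMod n), IsBundleChart π φ ∧ x ∈ φ.source := by
  obtain ⟨Q, _, _, _, hQ⟩ := h.exists_trivialization
  obtain ⟨e, het, he, he'⟩ := hQ (π x)
  have hx : x ∈ e.source := e.mem_source.2 het
  let c := chartAt (Fib n) (e x).2
  let d := (OpenPartialHomeomorph.refl ℝ).prod c
  have hd : ContMDiffOn (𝓘(ℝ, ℝ).prod 𝓘(ℝ, Fib n)) 𝓘(ℝ, EMod n) ∞ d d.source := by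
    rw [modelWithCornersSelf_prod, ← chartedSpaceSelf_prod]
    exact contMDiffOn_id.prodMap contMDiffOn_chart
  have hd' : ContMDiffOn 𝓘(ℝ, EMod n) (𝓘(ℝ, ℝ).prod 𝓘(ℝ, Fib n)) ∞ d.symm d.target := by
    rw [modelWithCornersSelf_prod, ← chartedSpaceSelf_prod]
    exact contMDiffOn_id.prodMap contMDiffOn_chart_symm
  refine ⟨e.toOpenPartialHomeomorph ≫ₕ d, ⟨?_, ?_, ?_⟩, ?_⟩
  · exact hd.comp' he |>.mono (by intro y hy; simpa using hy)
  · exact he'.comp' hd' |>.mono (by intro y hy; simpa using hy)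
  · intro y hy
    exact e.coe_fst (by simp at hy; exact hy.1)
  · simp [d, c, hx]

namespace IsBundleChart
variable {π : E → ℝ} {φ ψ : OpenPartialHomeomorph E (EMod n)}

theorem mdiff (hφ : IsBundleChart π φ) :
    φ.MDifferentiable 𝓘(ℝ, EMod n) 𝓘(ℝ, EMod n) :=
  ⟨hφ.smooth.mdifferentiableOn (by simp), hφ.smooth_symm.mdifferentiableOn (by simp)⟩

theorem toMod_fromMod (hφ : IsBundleChart π φ) {y : EMod n} (hy : y ∈ φ.target) (w : EMod n) :
    toMod φ (φ.symm y) (fromMod φ y w) = w :=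
  DFunLike.congr_fun (hφ.mdiff.comp_symm_deriv hy) w

theorem fromMod_toMod (hφ : IsBundleChart π φ) {y : EMod n} (hy : y ∈ φ.target)
    (w : TangentSpace 𝓘(ℝ, EMod n) (φ.symm y)) :
    fromMod φ y (toMod φ (φ.symm y) w) = w := by
  have h := DFunLike.congr_fun (hφ.mdiff.symm_comp_deriv (φ.map_target hy)) w
  have h2 : φ (φ.symm y) = y := φ.right_inv hy
  change (mfderiv 𝓘(ℝ, EMod n) 𝓘(ℝ, EMod n) φ.symm (φ (φ.symm y)) : EMod n → EMod n) _ = w at h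
  rw [h2] at h
  exact h

theorem toMod_inverse (hφ : IsBundleChart π φ) {y : EMod n} (hy : y ∈ φ.target) :
    (toMod φ (φ.symm y)).inverse = fromMod φ y :=
  ContinuousLinearMap.inverse_eq (ContinuousLinearMap.ext (hφ.toMod_fromMod hy))
    (ContinuousLinearMap.ext (hφ.fromMod_toMod hy))

theorem transition_contDiffOn (hφ : IsBundleChart π φ) (hψ : IsBundleChart π ψ) :
    ContDiffOn ℝ ∞ (ψ ∘ φ.symm) (φ.symm ≫ₕ ψ).source := by
  rw [← contMDiffOn_iff_contDiffOn]
  exact hψ.smooth.comp' hφ.smooth_symm |>.mono (by intro y hy; simpa using hy)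

theorem toMod_fromMod_transition (hφ : IsBundleChart π φ) (hψ : IsBundleChart π ψ) {y : EMod n}
    (hy : y ∈ (φ.symm ≫ₕ ψ).source) (w : EMod n) :
    toMod ψ (φ.symm y) (fromMod φ y w) = fderiv ℝ (ψ ∘ φ.symm) y w := by
  simp only [OpenPartialHomeomorph.trans_source, OpenPartialHomeomorph.symm_source, mem_inter_iff,
    mem_preimage] at hy
  have h := mfderiv_comp (I := 𝓘(ℝ, EMod n)) (I' := 𝓘(ℝ, EMod n)) (I'' := 𝓘(ℝ, EMod n)) y
    (hψ.mdiff.mdifferentiableAt hy.2) (hφ.mdiff.symm.mdifferentiableAt hy.1)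
  rw [mfderiv_eq_fderiv] at h
  exact (DFunLike.congr_fun h w).symm

theorem dt_eq (hφ : IsBundleChart π φ) {x : E} (hx : x ∈ φ.source)
    (w : TangentSpace 𝓘(ℝ, EMod n) x) :
    mvfderiv 𝓘(ℝ, EMod n) π x w = (toMod φ x w).1 := by
  have h1 : (fun z => (φ z).1) =ᶠ[𝓝 x] π :=
    Filter.eventuallyEq_of_mem (φ.open_source.mem_nhds hx) hφ.fst_eq
  have h2 := h1.mfderiv_eq (I := 𝓘(ℝ, EMod n)) (I' := 𝓘(ℝ, ℝ))
  have h3 := mfderiv_comp (I := 𝓘(ℝ, EMod n)) (I' := 𝓘(ℝ, EMod n)) (I'' := 𝓘(ℝ, ℝ)) x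
    (g := Prod.fst) (f := φ)
    (ContinuousLinearMap.fst ℝ ℝ (Fib n)).mdifferentiableAt (hφ.mdiff.mdifferentiableAt hx)
  have h4 : mfderiv 𝓘(ℝ, EMod n) 𝓘(ℝ, ℝ) (Prod.fst : EMod n → ℝ) (φ x)
      = ContinuousLinearMap.fst ℝ ℝ (Fib n) :=
    (ContinuousLinearMap.fst ℝ ℝ (Fib n)).hasMFDerivAt.mfderiv
  rw [h4] at h3
  change mfderiv 𝓘(ℝ, EMod n) 𝓘(ℝ, ℝ) π x w = _
  have h5 := h2.symm.trans h3
  exact DFunLike.congr_fun h5 w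

end IsBundleChart

theorem exists_unit (π : E → ℝ) [IsFibreBundle n π] (x : E) :
    ∃ w : TangentSpace 𝓘(ℝ, EMod n) x, mvfderiv 𝓘(ℝ, EMod n) π x w = 1 := by
  obtain ⟨φ, hφ, hx⟩ := exists_bundleChart (n := n) π x
  obtain ⟨y, hy, rfl⟩ : ∃ y ∈ φ.target, φ.symm y = x := ⟨φ x, φ.map_source hx, φ.left_inv hx⟩
  exact ⟨fromMod φ y (1, 0), by rw [hφ.dt_eq hx, hφ.toMod_fromMod hy]⟩


/-- An atlas with smooth transition maps makes a smooth manifold. -/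
theorem isManifold_of_core {V : Type*} [NormedAddCommGroup V] [NormedSpace ℝ V] {M : Type*}
    (c : ChartedSpaceCore V M)
    (h : ∀ e e' : PartialEquiv M V, e ∈ c.atlas → e' ∈ c.atlas →
      ContDiffOn ℝ ∞ (e.symm.trans e') (e.symm.trans e').source) :
    @IsManifold ℝ _ V _ _ V _ 𝓘(ℝ, V) ∞ M c.toTopologicalSpace c.toChartedSpace := by
  let _ := c.toTopologicalSpace
  let _ := c.toChartedSpace
  apply isManifold_of_contDiffOn
  rintro e e' he he'
  obtain ⟨f, hf, rfl⟩ : ∃ f, ∃ hf : f ∈ c.atlas, e = c.openPartialHomeomorph f hf := by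
    simpa only [exists_prop, mem_iUnion, mem_singleton_iff] using
      (show e ∈ ⋃ (f : PartialEquiv M V) (hf : f ∈ c.atlas), {c.openPartialHomeomorph f hf} from he)
  obtain ⟨f', hf', rfl⟩ : ∃ f, ∃ hf : f ∈ c.atlas, e' = c.openPartialHomeomorph f hf := by
    simpa only [exists_prop, mem_iUnion, mem_singleton_iff] using
      (show e' ∈ ⋃ (f : PartialEquiv M V) (hf : f ∈ c.atlas), {c.openPartialHomeomorph f hf}
        from he')
  exact (h f f' hf hf').mono (fun y hy => hy.1)

/-- The first jet space `J¹π`, as the affine subbundle `{v ∈ TE | ⟨dt, v⟩ = 1}` of `TE`. The field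
`pt` is the projection `π_{1,0} : J¹π → E`, and `vel` is the embedding `j : J¹π → TE`. -/
structure J1 (n : ℕ) {E : Type u} [TopologicalSpace E] [ChartedSpace (EMod n) E]
    (π : E → ℝ) where
  pt : E
  vel : TangentSpace 𝓘(ℝ, EMod n) pt
  dt_vel : mvfderiv 𝓘(ℝ, EMod n) π pt vel = 1

namespace J1
variable {π : E → ℝ}

theorem mk_congr {x : E} {u w : TangentSpace 𝓘(ℝ, EMod n) x}
    (hu : mvfderiv 𝓘(ℝ, EMod n) π x u = 1) (h : u = w) :
    (⟨x, u, hu⟩ : J1 n π) = ⟨x, w, h ▸ hu⟩ := by subst h; rfl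

/-- The jet with velocity `u` if `⟨dt, u⟩ = 1`; in general `u` is first corrected by a multiple of some
fixed vector, to have a total function. -/
def ofVec (π : E → ℝ) [IsFibreBundle n π] (x : E) (u : TangentSpace 𝓘(ℝ, EMod n) x) : J1 n π where
  pt := x
  vel := u + (1 - mvfderiv 𝓘(ℝ, EMod n) π x u) • (exists_unit π x).choose
  dt_vel := by
    rw [map_add, map_smul, (exists_unit (n := n) π x).choose_spec]; simp

theorem ofVec_eq [IsFibreBundle n π] {x : E} {u : TangentSpace 𝓘(ℝ, EMod n) x}
    (hu : mvfderiv 𝓘(ℝ, EMod n) π x u = 1) : ofVec π x u = ⟨x, u, hu⟩ :=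
  mk_congr _ (by rw [hu, sub_self, zero_smul, add_zero])

theorem ofVec_fromMod [IsFibreBundle n π] {φ : OpenPartialHomeomorph E (EMod n)}
    (hφ : IsBundleChart π φ) {y : EMod n} (hy : y ∈ φ.target) (w : Fib n) :
    (ofVec π (φ.symm y) (fromMod φ y (1, w))).vel = fromMod φ y (1, w) := by
  rw [ofVec_eq]
  rw [hφ.dt_eq (φ.map_target hy), hφ.toMod_fromMod hy]

variable [IsFibreBundle n π]

/-- The natural chart `(t, q, q̇)` of `J¹π` induced by a bundle chart `φ = (t, q)` of `E`. -/
def chart (φ : OpenPartialHomeomorph E (EMod n)) (hφ : IsBundleChart π φ) :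
    PartialEquiv (J1 n π) (EMod n × Fib n) where
  toFun v := (φ v.pt, (toMod φ v.pt v.vel).2)
  invFun z := ofVec π (φ.symm z.1) (fromMod φ z.1 (1, z.2))
  source := {v | v.pt ∈ φ.source}
  target := φ.target ×ˢ univ
  map_source' v hv := ⟨φ.map_source hv, mem_univ _⟩
  map_target' z hz := φ.map_target hz.1
  left_inv' := by
    rintro ⟨x, u, hu⟩ hx
    obtain ⟨y, hy, rfl⟩ : ∃ y ∈ φ.target, φ.symm y = x := ⟨φ x, φ.map_source hx, φ.left_inv hx⟩
    have h1 : ((1 : ℝ), (toMod φ (φ.symm y) u).2) = toMod φ (φ.symm y) u := by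
      ext1
      · rw [← hφ.dt_eq hx, hu]
      · rfl
    have key : ofVec π (φ.symm y) (fromMod φ y (1, (toMod φ (φ.symm y) u).2)) = ⟨φ.symm y, u, hu⟩ := by
      rw [h1, hφ.fromMod_toMod hy, ofVec_eq hu]
    have h2 : φ (φ.symm y) = y := φ.right_inv hy
    dsimp only
    rw [h2]
    exact key
  right_inv' := by
    rintro ⟨y, w⟩ ⟨hy, -⟩
    ext1
    · exact φ.right_inv hy
    · change (toMod φ (φ.symm y) (ofVec π (φ.symm y) (fromMod φ y (1, w))).vel).2 = w
      rw [ofVec_fromMod hφ hy, hφ.toMod_fromMod hy]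

theorem chart_trans_source {φ ψ : OpenPartialHomeomorph E (EMod n)} (hφ : IsBundleChart π φ)
    (hψ : IsBundleChart π ψ) :
    ((chart φ hφ).symm.trans (chart ψ hψ)).source = (φ.symm ≫ₕ ψ).source ×ˢ univ := by
  ext ⟨y, w⟩
  change ((y ∈ φ.target ∧ w ∈ univ) ∧ φ.symm y ∈ ψ.source) ↔
    ((y ∈ φ.target ∧ φ.symm y ∈ ψ.source) ∧ w ∈ univ)
  tauto

theorem chart_trans_contDiffOn {φ ψ : OpenPartialHomeomorph E (EMod n)} (hφ : IsBundleChart π φ)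
    (hψ : IsBundleChart π ψ) :
    ContDiffOn ℝ ∞ ((chart φ hφ).symm.trans (chart ψ hψ))
      ((chart φ hφ).symm.trans (chart ψ hψ)).source := by
  rw [chart_trans_source]
  have hg := hφ.transition_contDiffOn hψ
  have hfst : ContDiffOn ℝ ∞ (fun z : EMod n × Fib n => z.1) ((φ.symm ≫ₕ ψ).source ×ˢ univ) :=
    contDiff_fst.contDiffOn
  have hsnd : ContDiffOn ℝ ∞ (fun z : EMod n × Fib n => ((1 : ℝ), z.2))
      ((φ.symm ≫ₕ ψ).source ×ˢ univ) := (contDiff_const.prodMk contDiff_snd).contDiffOn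
  have hd := hg.fderiv_of_isOpen (m := ∞) (φ.symm ≫ₕ ψ).open_source (by simp)
  have h2 := (hd.comp hfst (fun z hz => hz.1)).clm_apply hsnd
  refine ((hg.comp hfst (fun z hz => hz.1)).prodMk (contDiff_snd.comp_contDiffOn h2)).congr ?_
  rintro ⟨y, w⟩ ⟨hy, -⟩
  have hy' : y ∈ φ.target := by simp at hy; exact hy.1
  ext1
  · rfl
  · change (toMod ψ (φ.symm y) (ofVec π (φ.symm y) (fromMod φ y (1, w))).vel).2 = _
    rw [ofVec_fromMod hφ hy', hφ.toMod_fromMod_transition hψ hy]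
    rfl

/-- The atlas of `J¹π` formed by all natural charts. -/
def core (n : ℕ) {E : Type u} [TopologicalSpace E] [ChartedSpace (EMod n) E] (π : E → ℝ)
    [IsFibreBundle n π] : ChartedSpaceCore (EMod n × Fib n) (J1 n π) where
  atlas := {c | ∃ φ, ∃ hφ : IsBundleChart π φ, c = chart φ hφ}
  chartAt v := chart (exists_bundleChart π v.pt).choose (exists_bundleChart π v.pt).choose_spec.1
  mem_chart_source v := (exists_bundleChart (n := n) π v.pt).choose_spec.2
  chart_mem_atlas v := ⟨_, _, rfl⟩
  open_source := by
    rintro _ _ ⟨φ, hφ, rfl⟩ ⟨ψ, hψ, rfl⟩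
    rw [chart_trans_source]
    exact (φ.symm ≫ₕ ψ).open_source.prod isOpen_univ
  continuousOn_toFun := by
    rintro _ _ ⟨φ, hφ, rfl⟩ ⟨ψ, hψ, rfl⟩
    exact (chart_trans_contDiffOn hφ hψ).continuousOn

instance : TopologicalSpace (J1 n π) := (core n π).toTopologicalSpace
instance : ChartedSpace (EMod n × Fib n) (J1 n π) := (core n π).toChartedSpace
instance : IsManifold 𝓘(ℝ, EMod n × Fib n) ∞ (J1 n π) :=
  isManifold_of_core _ (by
    rintro _ _ ⟨φ, hφ, rfl⟩ ⟨ψ, hψ, rfl⟩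
    exact chart_trans_contDiffOn hφ hψ)

end J1

/-- The fibred product `T*E ×_E J¹π`: a jet and a covector at the same point of `E`. -/
structure Mixed (n : ℕ) {E : Type u} [TopologicalSpace E] [ChartedSpace (EMod n) E]
    (π : E → ℝ) where
  jet : J1 n π
  cov : TangentSpace 𝓘(ℝ, EMod n) jet.pt →L[ℝ] ℝ

/-- Model space of `T*E ×_E J¹π`, with coordinates `((t, q), (τ, p), q̇)`. -/
abbrev PMod (n : ℕ) : Type := EMod n × (EMod n →L[ℝ] ℝ) × Fib n

namespace Mixed
variable {π : E → ℝ}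

theorem mk_congr {v w : J1 n π} {a : TangentSpace 𝓘(ℝ, EMod n) v.pt →L[ℝ] ℝ}
    {b : TangentSpace 𝓘(ℝ, EMod n) w.pt →L[ℝ] ℝ} (h : v = w) (h' : HEq a b) :
    (⟨v, a⟩ : Mixed n π) = ⟨w, b⟩ := by subst h; cases h'; rfl

variable [IsFibreBundle n π]

/-- The natural chart `((t, q), (τ, p), q̇)` of `T*E ×_E J¹π` induced by a bundle chart `φ = (t, q)`;
`(τ, p)` is recorded as the covector `τ dt + p dq` on the model space. -/
def chart (φ : OpenPartialHomeomorph E (EMod n)) (hφ : IsBundleChart π φ) :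
    PartialEquiv (Mixed n π) (PMod n) where
  toFun p := (φ p.jet.pt, p.cov ∘L (toMod φ p.jet.pt).inverse, (toMod φ p.jet.pt p.jet.vel).2)
  invFun z := ⟨J1.ofVec π (φ.symm z.1) (fromMod φ z.1 (1, z.2.2)), z.2.1 ∘L toMod φ (φ.symm z.1)⟩
  source := {p | p.jet.pt ∈ φ.source}
  target := φ.target ×ˢ univ
  map_source' v hv := ⟨φ.map_source hv, mem_univ _⟩
  map_target' z hz := φ.map_target hz.1
  left_inv' := by
    rintro ⟨⟨x, u, hu⟩, a⟩ hx
    obtain ⟨y, hy, rfl⟩ : ∃ y ∈ φ.target, φ.symm y = x := ⟨φ x, φ.map_source hx, φ.left_inv hx⟩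
    have h2 : φ (φ.symm y) = y := φ.right_inv hy
    have h3 : (a ∘L fromMod φ y) ∘L toMod φ (φ.symm y) = a := by
      refine ContinuousLinearMap.ext fun w => ?_
      exact congrArg a (hφ.fromMod_toMod hy w)
    have h4 := (J1.chart φ hφ).left_inv (x := ⟨φ.symm y, u, hu⟩) hx
    change J1.ofVec π (φ.symm (φ (φ.symm y)))
      (fromMod φ (φ (φ.symm y)) (1, (toMod φ (φ.symm y) u).2)) = _ at h4
    dsimp only
    rw [hφ.toMod_inverse hy]
    rw [h2] at h4 ⊢
    exact mk_congr h4 (heq_of_eq h3)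
  right_inv' := by
    rintro ⟨y, a, w⟩ ⟨hy, -⟩
    have h := (J1.chart φ hφ).right_inv (x := (y, w)) ⟨hy, mem_univ _⟩
    have h1 : φ (φ.symm y) = y := congrArg Prod.fst h
    have h2 : (toMod φ (φ.symm y) (J1.ofVec π (φ.symm y) (fromMod φ y (1, w))).vel).2 = w :=
      congrArg Prod.snd h
    have h3 : (a ∘L toMod φ (φ.symm y)) ∘L (toMod φ (φ.symm y)).inverse = a := by
      rw [hφ.toMod_inverse hy]
      refine ContinuousLinearMap.ext fun w => ?_
      exact congrArg a (hφ.toMod_fromMod hy w)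
    exact Prod.ext h1 (Prod.ext h3 h2)

theorem chart_trans_source {φ ψ : OpenPartialHomeomorph E (EMod n)} (hφ : IsBundleChart π φ)
    (hψ : IsBundleChart π ψ) :
    ((chart φ hφ).symm.trans (chart ψ hψ)).source = (φ.symm ≫ₕ ψ).source ×ˢ univ := by
  ext ⟨y, w⟩
  change ((y ∈ φ.target ∧ w ∈ univ) ∧ φ.symm y ∈ ψ.source) ↔
    ((y ∈ φ.target ∧ φ.symm y ∈ ψ.source) ∧ w ∈ univ)
  tauto

theorem chart_trans_contDiffOn {φ ψ : OpenPartialHomeomorph E (EMod n)} (hφ : IsBundleChart π φ)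
    (hψ : IsBundleChart π ψ) :
    ContDiffOn ℝ ∞ ((chart φ hφ).symm.trans (chart ψ hψ))
      ((chart φ hφ).symm.trans (chart ψ hψ)).source := by
  rw [chart_trans_source]
  have hg := hφ.transition_contDiffOn hψ
  have hfst : ContDiffOn ℝ ∞ (fun z : PMod n => z.1) ((φ.symm ≫ₕ ψ).source ×ˢ univ) :=
    contDiff_fst.contDiffOn
  have hjet : ContDiffOn ℝ ∞ (fun z : PMod n => (z.1, z.2.2)) ((φ.symm ≫ₕ ψ).source ×ˢ univ) :=
    (contDiff_fst.prodMk (contDiff_snd.comp contDiff_snd)).contDiffOn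
  have hJ := J1.chart_trans_contDiffOn hφ hψ
  rw [J1.chart_trans_source] at hJ
  have h2 := hJ.comp hjet (fun z hz => ⟨hz.1, mem_univ _⟩)
  have hd := (hψ.transition_contDiffOn hφ).fderiv_of_isOpen (m := ∞)
    (ψ.symm ≫ₕ φ).open_source (by simp)
  have hmaps : ∀ y ∈ (φ.symm ≫ₕ ψ).source, ψ (φ.symm y) ∈ (ψ.symm ≫ₕ φ).source := by
    intro y hy
    simp only [OpenPartialHomeomorph.trans_source, OpenPartialHomeomorph.symm_source,
      mem_inter_iff, mem_preimage] at hy ⊢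
    exact ⟨ψ.map_source hy.2, by rw [ψ.left_inv hy.2]; exact φ.map_target hy.1⟩
  have h3 := hd.comp (hg.comp hfst (fun z hz => hz.1)) (fun z hz => hmaps _ hz.1)
  have hcov : ContDiffOn ℝ ∞ (fun z : PMod n => z.2.1) ((φ.symm ≫ₕ ψ).source ×ˢ univ) :=
    (contDiff_fst.comp contDiff_snd).contDiffOn
  have h4 := hcov.clm_comp h3
  refine ((contDiff_fst.comp_contDiffOn h2).prodMk
    (h4.prodMk (contDiff_snd.comp_contDiffOn h2))).congr ?_
  rintro ⟨y, a, w⟩ ⟨hy, -⟩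
  refine Prod.ext rfl (Prod.ext ?_ rfl)
  change (a ∘L toMod φ (φ.symm y)) ∘L (toMod ψ (φ.symm y)).inverse =
    a ∘L fderiv ℝ (φ ∘ ψ.symm) (ψ (φ.symm y))
  have hy2 := hmaps y hy
  have hy3 : φ.symm y ∈ ψ.source := by simp at hy; exact hy.2
  have hyt : ψ (φ.symm y) ∈ ψ.target := ψ.map_source hy3
  obtain ⟨y', hy', hyy⟩ : ∃ y' ∈ ψ.target, ψ.symm y' = φ.symm y :=
    ⟨_, hyt, ψ.left_inv hy3⟩
  rw [← hyy, ψ.right_inv hy', hψ.toMod_inverse hy']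
  rw [← hyy, ψ.right_inv hy'] at hy2
  refine ContinuousLinearMap.ext fun w => ?_
  exact congrArg a (hψ.toMod_fromMod_transition hφ hy2 w)

/-- The atlas of `T*E ×_E J¹π` formed by all natural charts. -/
def core (n : ℕ) {E : Type u} [TopologicalSpace E] [ChartedSpace (EMod n) E] (π : E → ℝ)
    [IsFibreBundle n π] : ChartedSpaceCore (PMod n) (Mixed n π) where
  atlas := {c | ∃ φ, ∃ hφ : IsBundleChart π φ, c = chart φ hφ}
  chartAt p := chart (exists_bundleChart π p.jet.pt).choose
    (exists_bundleChart π p.jet.pt).choose_spec.1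
  mem_chart_source p := (exists_bundleChart (n := n) π p.jet.pt).choose_spec.2
  chart_mem_atlas p := ⟨_, _, rfl⟩
  open_source := by
    rintro _ _ ⟨φ, hφ, rfl⟩ ⟨ψ, hψ, rfl⟩
    rw [chart_trans_source]
    exact (φ.symm ≫ₕ ψ).open_source.prod isOpen_univ
  continuousOn_toFun := by
    rintro _ _ ⟨φ, hφ, rfl⟩ ⟨ψ, hψ, rfl⟩
    exact (chart_trans_contDiffOn hφ hψ).continuousOn

instance : TopologicalSpace (Mixed n π) := (core n π).toTopologicalSpace
instance : ChartedSpace (PMod n) (Mixed n π) := (core n π).toChartedSpace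
instance : IsManifold 𝓘(ℝ, PMod n) ∞ (Mixed n π) :=
  isManifold_of_core _ (by
    rintro _ _ ⟨φ, hφ, rfl⟩ ⟨ψ, hψ, rfl⟩
    exact chart_trans_contDiffOn hφ hψ)

end Mixed

section Forms
variable {V : Type*} [NormedAddCommGroup V] [NormedSpace ℝ V] {H : Type*} [TopologicalSpace H]
  (I : ModelWithCorners ℝ V H) {M : Type*} [TopologicalSpace M] [ChartedSpace H M]

/-- `(α ∧ β)(u, w) = α(u) β(w) - α(w) β(u)`. -/
def wedge {x : M} (α β : TangentSpace I x →L[ℝ] ℝ) : LinearMap.BilinForm ℝ (TangentSpace I x) :=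
  LinearMap.mk₂ ℝ (fun u w => α u * β w - α w * β u)
    (fun u u' w => by simp only [map_add]; ring)
    (fun c u w => by simp only [map_smul, smul_eq_mul]; ring)
    (fun u w w' => by simp only [map_add]; ring)
    (fun c u w => by simp only [map_smul, smul_eq_mul]; ring)

/-- The local representative of a `1`-form in the preferred chart at `x`. -/
def localRep (θ : ∀ x : M, TangentSpace I x →L[ℝ] ℝ) (x : M) (y : V) : V →L[ℝ] ℝ :=
  θ ((extChartAt I x).symm y) ∘L mfderiv 𝓘(ℝ, V) I (extChartAt I x).symm y

/-- The exterior derivative of a `1`-form `θ` on a manifold without boundary, computed at `x` in the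
preferred chart at `x`: `dθ(u, w) = (D_u θ)(w) - (D_w θ)(u)`. -/
def dForm (θ : ∀ x : M, TangentSpace I x →L[ℝ] ℝ) (x : M) :
    LinearMap.BilinForm ℝ (TangentSpace I x) :=
  let A : V →L[ℝ] V →L[ℝ] ℝ := fderiv ℝ (localRep I θ x) (extChartAt I x x)
  let C : TangentSpace I x →L[ℝ] V := mvfderiv I (extChartAt I x) x
  LinearMap.mk₂ ℝ (fun u w => A (C u) (C w) - A (C w) (C u))
    (fun u u' w => by simp only [map_add, add_apply]; ring)
    (fun c u w => by
      simp only [map_smul, smul_apply, smul_eq_mul]; ring)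
    (fun u w w' => by simp only [map_add, add_apply]; ring)
    (fun c u w => by
      simp only [map_smul, smul_apply, smul_eq_mul]; ring)

variable {V' : Type*} [NormedAddCommGroup V'] [NormedSpace ℝ V'] {H' : Type*} [TopologicalSpace H']
  (I' : ModelWithCorners ℝ V' H') {M' : Type*} [TopologicalSpace M'] [ChartedSpace H' M']

/-- The pull-back `f^*Ω` of a field of bilinear forms. -/
def pullbackForm (f : M → M') (Ω : ∀ y : M', LinearMap.BilinForm ℝ (TangentSpace I' y)) (x : M) :
    LinearMap.BilinForm ℝ (TangentSpace I x) :=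
  (Ω (f x)).compl₁₂ (mfderiv I I' f x).toLinearMap (mfderiv I I' f x).toLinearMap
end Forms

section Cot
/-- The cotangent bundle `T*E`, with the manifold structure that Mathlib puts on the bundle
`Hom(TE, ℝ)`. -/
abbrev CotBundle (n : ℕ) (E : Type u) [TopologicalSpace E] [ChartedSpace (EMod n) E]
    [IsManifold 𝓘(ℝ, EMod n) ∞ E] : Type u :=
  Bundle.TotalSpace (EMod n →L[ℝ] ℝ)
    (fun x : E => TangentSpace 𝓘(ℝ, EMod n) x →L[ℝ] Bundle.Trivial E ℝ x)

/-- The model of `T*E`. -/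
abbrev ICot (n : ℕ) := 𝓘(ℝ, EMod n).prod 𝓘(ℝ, EMod n →L[ℝ] ℝ)

variable [IsManifold 𝓘(ℝ, EMod n) ∞ E]



/-- The Liouville `1`-form `τ dt + p_A dq^A` on `T*E`. -/
def liouville (α : CotBundle n E) : TangentSpace (ICot n) α →L[ℝ] ℝ :=
  α.2 ∘L mfderiv (ICot n) 𝓘(ℝ, EMod n) Bundle.TotalSpace.proj α

/-- The canonical symplectic form `ω_E = dq^A ∧ dp_A + dt ∧ dτ` on `T*E`. -/
def canonicalForm (α : CotBundle n E) : LinearMap.BilinForm ℝ (TangentSpace (ICot n) α) :=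
  -dForm (ICot n) liouville α

end Cot

section Lagrangian
variable [IsManifold 𝓘(ℝ, EMod n) ∞ E] {π : E → ℝ} [IsFibreBundle n π]

/-- The model of `J¹π`. -/
abbrev IJ (n : ℕ) := 𝓘(ℝ, EMod n × Fib n)
/-- The model of `T*E ×_E J¹π`. -/
abbrev IP (n : ℕ) := 𝓘(ℝ, PMod n)

/-- The projection `π_1 : J¹π → ℝ`. -/
def pi1 (v : J1 n π) : ℝ := π v.pt

/-- The `1`-form `π_1^* dt` on `J¹π`. -/
def etaJ (v : J1 n π) : TangentSpace (IJ n) v →L[ℝ] ℝ := mvfderiv (IJ n) pi1 v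

/-- The jet `v + (w - ⟨dt, w⟩ v)` over the base point of `v`. -/
def vshift (v : J1 n π) (w : TangentSpace 𝓘(ℝ, EMod n) v.pt) : J1 n π where
  pt := v.pt
  vel := v.vel + (w - mvfderiv 𝓘(ℝ, EMod n) π v.pt w • v.vel)
  dt_vel := by
    rw [map_add, map_sub, map_smul, v.dt_vel, smul_eq_mul, mul_one, sub_self, add_zero]

theorem vshift_zero (v : J1 n π) : vshift v 0 = v :=
  J1.mk_congr _ (by rw [map_zero, zero_smul, sub_zero, add_zero])

/-- The vertical lift to `v` of the vertical part `w - ⟨dt, w⟩ v` of `w ∈ T_{π_{1,0}(v)}E`, that is,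
the velocity at `s = 0` of the curve `s ↦ v + s (w - ⟨dt, w⟩ v)` (recall `vshift v 0 = v`). -/
def vlift (v : J1 n π) : TangentSpace 𝓘(ℝ, EMod n) v.pt →L[ℝ] TangentSpace (IJ n) v :=
  mfderiv 𝓘(ℝ, EMod n) (IJ n) (fun w : EMod n => vshift v w) 0

/-- The vertical endomorphism `S = (dq^A - q̇^A dt) ⊗ ∂/∂q̇^A` of `J¹π`. -/
def vertEndo (v : J1 n π) : TangentSpace (IJ n) v →L[ℝ] TangentSpace (IJ n) v :=
  vlift v ∘L mfderiv (IJ n) 𝓘(ℝ, EMod n) J1.pt v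

/-- The Poincaré–Cartan `1`-form `Θ_L = L π_1^*dt + S^*(dL)`. -/
def poincareCartan (L : J1 n π → ℝ) (v : J1 n π) : TangentSpace (IJ n) v →L[ℝ] ℝ :=
  L v • etaJ v + mvfderiv (IJ n) L v ∘L vertEndo v

/-- The Poincaré–Cartan `2`-form `ω_L = -dΘ_L`. -/
def omegaL (L : J1 n π → ℝ) (v : J1 n π) : LinearMap.BilinForm ℝ (TangentSpace (IJ n) v) :=
  -dForm (IJ n) (poincareCartan L) v

/-- `X` solves `i_X ω_L = 0`, `i_X (π_1^* dt) = 1` on `J¹π`. For a regular Lagrangian the unique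
solution is the Euler–Lagrange vector field `X_L`. -/
structure IsEulerLagrangeField (L : J1 n π → ℝ) (X : ∀ v : J1 n π, TangentSpace (IJ n) v) :
    Prop where
  omegaL_eq : ∀ v, omegaL L v (X v) = 0
  eta_eq : ∀ v, etaJ v (X v) = 1

/-- The covector `Leg_L(v)`; in coordinates `τ = L - q̇^A ∂L/∂q̇^A`, `p_A = ∂L/∂q̇^A`. It is
characterised by `legendreCov_apply` below. -/
def legendreCov (L : J1 n π → ℝ) (v : J1 n π) : TangentSpace 𝓘(ℝ, EMod n) v.pt →L[ℝ] ℝ :=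
  L v • mvfderiv 𝓘(ℝ, EMod n) π v.pt + mvfderiv (IJ n) L v ∘L vlift v

/-- The extended Legendre map `Leg_L : J¹π → T*E`. -/
def legendre (L : J1 n π → ℝ) (v : J1 n π) : CotBundle n E := ⟨v.pt, legendreCov L v⟩

/-- The projection `π_{1,0}` is smooth. -/
theorem contMDiff_pt : ContMDiff (IJ n) 𝓘(ℝ, EMod n) ∞ (J1.pt : J1 n π → E) := by
  intro v
  obtain ⟨φ, hφ, hc⟩ : ∃ φ : OpenPartialHomeomorph E (EMod n), ∃ hφ : IsBundleChart π φ,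
      (J1.core n π).chartAt v = J1.chart φ hφ := (J1.core n π).chart_mem_atlas v
  have hsrc : (chartAt (EMod n × Fib n) v).source = {w : J1 n π | w.pt ∈ φ.source} := by
    change ((J1.core n π).chartAt v).source = _
    rw [hc]; rfl
  have hfun : ∀ w : J1 n π, (chartAt (EMod n × Fib n) v w).1 = φ w.pt := by
    intro w
    change ((J1.core n π).chartAt v w).1 = _
    rw [hc]; rfl
  have hv : v.pt ∈ φ.source := by
    have := mem_chart_source (EMod n × Fib n) v
    rwa [hsrc] at this
  have h1 : ContMDiffAt (IJ n) (IJ n) ∞ (chartAt (EMod n × Fib n) v) v :=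
    (contMDiffOn_chart (I := IJ n)).contMDiffAt
      ((chartAt (EMod n × Fib n) v).open_source.mem_nhds (mem_chart_source _ v))
  have h2 : ContMDiffAt (IJ n) 𝓘(ℝ, EMod n) ∞
      (fun w => (chartAt (EMod n × Fib n) v w).1) v :=
    (contDiff_fst (𝕜 := ℝ) (E := EMod n) (F := Fib n)).contMDiff.contMDiffAt.comp v h1
  have h3 : ContMDiffAt 𝓘(ℝ, EMod n) 𝓘(ℝ, EMod n) ∞ φ.symm (chartAt (EMod n × Fib n) v v).1 := by
    rw [hfun]
    exact hφ.smooth_symm.contMDiffAt (φ.open_target.mem_nhds (φ.map_source hv))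
  refine (h3.comp v h2).congr_of_eventuallyEq ?_
  filter_upwards [(chartAt (EMod n × Fib n) v).open_source.mem_nhds (mem_chart_source _ v)]
    with w hw
  rw [hsrc] at hw
  simp only [Function.comp_apply, hfun]
  exact (φ.left_inv hw).symm

/-- `Leg_L(v)(w) = Θ_L(ξ)` for each `ξ ∈ T_v J¹π` that projects to `w ∈ TE`. -/
theorem legendreCov_apply (L : J1 n π → ℝ) (v : J1 n π) (ξ : TangentSpace (IJ n) v) :
    legendreCov L v (mfderiv (IJ n) 𝓘(ℝ, EMod n) J1.pt v ξ) = poincareCartan L v ξ := by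
  obtain ⟨φ, hφ, hx⟩ := exists_bundleChart (n := n) π v.pt
  have hπ : MDifferentiableAt 𝓘(ℝ, EMod n) 𝓘(ℝ, ℝ) π v.pt := by
    have h1 : (fun z => (φ z).1) =ᶠ[𝓝 v.pt] π :=
      Filter.eventuallyEq_of_mem (φ.open_source.mem_nhds hx) hφ.fst_eq
    refine MDifferentiableAt.congr_of_eventuallyEq ?_ h1.symm
    exact ((ContinuousLinearMap.fst ℝ ℝ (Fib n)).mdifferentiableAt (x := φ v.pt)).comp v.pt
      (hφ.mdiff.mdifferentiableAt hx)
  have h := mfderiv_comp v hπ ((contMDiff_pt (n := n) (π := π) v).mdifferentiableAt (by simp))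
  have h' : etaJ v ξ = mvfderiv 𝓘(ℝ, EMod n) π v.pt (mfderiv (IJ n) 𝓘(ℝ, EMod n) J1.pt v ξ) :=
    DFunLike.congr_fun h ξ
  change L v * _ + _ = L v * etaJ v ξ + _
  rw [h']
  rfl

/-- The matrix `∂²L/∂q̇^A∂q̇^B` at the jet `v` in a natural chart. -/
def hessian (L : J1 n π → ℝ) (φ : OpenPartialHomeomorph E (EMod n)) (hφ : IsBundleChart π φ)
    (v : J1 n π) : Matrix (Fin n) (Fin n) ℝ :=
  Matrix.of fun A B =>
    fderiv ℝ (fun w => fderiv ℝ (fun w' => L ((J1.chart φ hφ).symm (φ v.pt, w'))) w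
      (EuclideanSpace.single B 1)) (J1.chart φ hφ v).2 (EuclideanSpace.single A 1)

/-- `L` is regular: its Hessian with respect to the velocities is everywhere non-singular. -/
def IsRegular (L : J1 n π → ℝ) : Prop :=
  ∀ (φ : OpenPartialHomeomorph E (EMod n)) (hφ : IsBundleChart π φ) (v : J1 n π),
    v.pt ∈ φ.source → (hessian L φ hφ v).det ≠ 0

/-- The projection onto `T*E`. -/
def pr1 (p : Mixed n π) : CotBundle n E := ⟨p.jet.pt, p.cov⟩
/-- The projection onto `J¹π`. -/
def pr2 (p : Mixed n π) : J1 n π := p.jet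

/-- The `1`-form `η = (π ∘ pr)^* dt` on `T*E ×_E J¹π`. -/
def eta (p : Mixed n π) : TangentSpace (IP n) p →L[ℝ] ℝ := mvfderiv (IP n) (fun q => π (pr1 q).proj) p

/-- The function `⟨pr_1, j ∘ pr_2⟩ - pr_2^* L`, in coordinates `p_A q̇^A + τ - L`. -/
def energy (L : J1 n π → ℝ) (p : Mixed n π) : ℝ := p.cov p.jet.vel - L (pr2 p)

/-- The `2`-form `ω_H = pr_1^* ω_E + dH ∧ η`. -/
def omegaH (L : J1 n π → ℝ) (p : Mixed n π) : LinearMap.BilinForm ℝ (TangentSpace (IP n) p) :=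
  pullbackForm (IP n) (ICot n) pr1 canonicalForm p + wedge (IP n) (mvfderiv (IP n) (energy L) p) (eta p)

/-- The map `Leg_L ×_E id : J¹π → T*E ×_E J¹π`. -/
def graphMap (L : J1 n π → ℝ) (v : J1 n π) : Mixed n π := ⟨v, legendreCov L v⟩

theorem pr1_graphMap (L : J1 n π → ℝ) (v : J1 n π) : pr1 (graphMap L v) = legendre L v := rfl

/-- The graph of `Leg_L`. -/
def graphL (L : J1 n π → ℝ) : Set (Mixed n π) := range (graphMap L)

/-- `Z`, a field of tangent vectors of `T*E ×_E J¹π` defined at the points of `graph_L`, solves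
`i_Z ω_H = 0`, `i_Z η = 1` there and is tangent to `graph_L`. The tangent space of `graph_L` is the
image of the differential of its parametrisation `Leg_L ×_E id`. -/
structure IsSRSolution (L : J1 n π → ℝ) (Z : ∀ p : graphL L, TangentSpace (IP n) p.1) : Prop where
  omegaH_eq : ∀ p, omegaH L p.1 (Z p) = 0
  eta_eq : ∀ p, eta p.1 (Z p) = 1
  tangent : ∀ v : J1 n π, Z ⟨graphMap L v, v, rfl⟩ ∈ (mfderiv (IJ n) (IP n) (graphMap L) v).range

/-- Smoothness of a vector field on `J¹π`. -/
def IsSmoothField (X : ∀ v : J1 n π, TangentSpace (IJ n) v) : Prop :=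
  ContMDiff (IJ n) (IJ n).tangent ∞ (fun v => (⟨v, X v⟩ : TangentBundle (IJ n) (J1 n π)))

/-- Smoothness of a vector field defined along `graph_L`, in the parametrisation of `graph_L` by
`Leg_L ×_E id : J¹π → graph_L` (whose inverse is the restriction of `pr_2`). -/
def IsSmoothAlong (L : J1 n π → ℝ) (Z : ∀ p : graphL L, TangentSpace (IP n) p.1) : Prop :=
  ContMDiff (IJ n) (IP n).tangent ∞
    (fun v => (⟨graphMap L v, Z ⟨graphMap L v, v, rfl⟩⟩ : TangentBundle (IP n) (Mixed n π)))
end Lagrangian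
end
end SkinnerRusk
end

/-!
Write `γ = Leg_L ×_E id`. The Liouville form pulls back along `Leg_L` to `Θ_L`, and the energy
`𝓗` vanishes along `γ`, so `γ^* ω_𝓗 = ω_L`. In natural coordinates the equations `i_X ω_L = 0`,
`i_X dt = 1` say that the curl of the Legendre covector, contracted with `X`, vanishes. Its
vertical part forces `dq/dt = q̇`, since the velocity Hessian is invertible; what remains is the
linear system `(∂²L/∂q̇∂q̇) q̈ = force`, which has one solution, depending smoothly on the point.
Hence `X_L` exists, is unique and is smooth.

Along `graph_L` the tangent space of `T^*E ×_E J¹π` is the sum of that of `graph_L` and the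
kernel of `T pr_2`. A tangent vector whose projection to `E` is a multiple of the velocity, such
as `γ_* X_L`, is `ω_𝓗`-orthogonal to this kernel. So for a tangent vector `γ_* X` of `graph_L` the
equation `i_Z ω_𝓗 = 0` reduces to `i_X ω_L = 0`, and `γ_* X_L` is the only solution.
-/

noncomputable section
namespace SkinnerRusk
universe u

section ExteriorDerivative

theorem fderiv_comp_fderiv_sub_swap {V W : Type*} [NormedAddCommGroup V] [NormedSpace ℝ V]
    [NormedAddCommGroup W] [NormedSpace ℝ W] {A : V → V →L[ℝ] ℝ} {F : W → V} {z : W}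
    (hA : DifferentiableAt ℝ A (F z)) (hF : ContDiffAt ℝ 2 F z) (u w : W) :
    fderiv ℝ (fun y => A (F y) ∘L fderiv ℝ F y) z u w -
        fderiv ℝ (fun y => A (F y) ∘L fderiv ℝ F y) z w u =
      fderiv ℝ A (F z) (fderiv ℝ F z u) (fderiv ℝ F z w) -
        fderiv ℝ A (F z) (fderiv ℝ F z w) (fderiv ℝ F z u) := by
  have hF' : DifferentiableAt ℝ (fderiv ℝ F) z :=
    (hF.fderiv_right (m := 1) (by norm_num)).differentiableAt one_ne_zero
  have hpull := (hA.hasFDerivAt.comp z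
    (hF.differentiableAt two_ne_zero).hasFDerivAt).clm_comp hF'.hasFDerivAt
  have hsymm : fderiv ℝ (fderiv ℝ F) z u w = fderiv ℝ (fderiv ℝ F) z w u :=
    hF.isSymmSndFDerivAt (by simp) u w
  simp only [Function.comp_def] at hpull
  rw [hpull.fderiv]
  simp [hsymm]

variable {V : Type*} [NormedAddCommGroup V] [NormedSpace ℝ V] {H : Type*} [TopologicalSpace H]
  {I : ModelWithCorners ℝ V H} {M : Type*} [TopologicalSpace M] [ChartedSpace H M]

theorem dForm_modelSpace (T : V → V →L[ℝ] ℝ) (x u w : V) :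
    dForm 𝓘(ℝ, V) T x u w = fderiv ℝ T x u w - fderiv ℝ T x w u := by
  have hrep : localRep 𝓘(ℝ, V) T x = T := by
    ext y u
    change T y (mfderiv 𝓘(ℝ, V) 𝓘(ℝ, V) id y u) = T y u
    rw [mfderiv_id]
    rfl
  have hchart : mvfderiv 𝓘(ℝ, V) (extChartAt 𝓘(ℝ, V) x) x = ContinuousLinearMap.id ℝ V :=
    mfderiv_id
  change fderiv ℝ (localRep 𝓘(ℝ, V) T x) x (mvfderiv 𝓘(ℝ, V) (extChartAt 𝓘(ℝ, V) x) x u)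
      (mvfderiv 𝓘(ℝ, V) (extChartAt 𝓘(ℝ, V) x) x w) -
    fderiv ℝ (localRep 𝓘(ℝ, V) T x) x (mvfderiv 𝓘(ℝ, V) (extChartAt 𝓘(ℝ, V) x) x w)
      (mvfderiv 𝓘(ℝ, V) (extChartAt 𝓘(ℝ, V) x) x u) = _
  rw [hrep, hchart]
  rfl

theorem dForm_congr [I.Boundaryless] {θ θ' : ∀ x : M, TangentSpace I x →L[ℝ] ℝ} {x : M}
    (h : ∀ᶠ y in 𝓝 x, θ y = θ' y) : dForm I θ x = dForm I θ' x := by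
  have hrep : localRep I θ x =ᶠ[𝓝 (extChartAt I x x)] localRep I θ' x := by
    have hsymm := continuousAt_extChartAt_symm (I := I) x
    rw [ContinuousAt, extChartAt_to_inv] at hsymm
    filter_upwards [hsymm.eventually h] with y hy
    simp only [localRep, hy]
  simp only [dForm, hrep.fderiv_eq]

variable {V' : Type*} [NormedAddCommGroup V'] [NormedSpace ℝ V'] {H' : Type*} [TopologicalSpace H']
  {I' : ModelWithCorners ℝ V' H'} {M' : Type*} [TopologicalSpace M'] [ChartedSpace H' M']
  {V'' : Type*} [NormedAddCommGroup V''] [NormedSpace ℝ V''] {H'' : Type*} [TopologicalSpace H'']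
  {I'' : ModelWithCorners ℝ V'' H''} {M'' : Type*} [TopologicalSpace M''] [ChartedSpace H'' M'']

/-- The pull-back `f^*θ` of a `1`-form, companion of `pullbackForm`. -/
def pullbackOneForm (I : ModelWithCorners ℝ V H) (I' : ModelWithCorners ℝ V' H') (f : M → M')
    (θ : ∀ y : M', TangentSpace I' y →L[ℝ] ℝ) (x : M) : TangentSpace I x →L[ℝ] ℝ :=
  θ (f x) ∘L mfderiv I I' f x

theorem pullbackOneForm_congr {f g : M → M'} {x : M} (h : f =ᶠ[𝓝 x] g)
    (θ : ∀ y : M', TangentSpace I' y →L[ℝ] ℝ) :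
    pullbackOneForm I I' f θ x = pullbackOneForm I I' g θ x := by
  have hθ : (θ (f x) : V' →L[ℝ] ℝ) = θ (g x) := by rw [h.eq_of_nhds]
  ext u
  change (θ (f x) : V' →L[ℝ] ℝ) (mfderiv I I' f x u) = θ (g x) (mfderiv I I' g x u)
  rw [hθ, h.mfderiv_eq]
  rfl

theorem pullbackOneForm_comp {f : M → M'} {g : M' → M''} {x : M}
    (hg : MDifferentiableAt I' I'' g (f x)) (hf : MDifferentiableAt I I' f x)
    (θ : ∀ y : M'', TangentSpace I'' y →L[ℝ] ℝ) :
    pullbackOneForm I I'' (g ∘ f) θ x = pullbackOneForm I I' f (pullbackOneForm I' I'' g θ) x := by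
  ext u
  simp only [pullbackOneForm, mfderiv_comp x hg hf]
  rfl

variable [IsManifold I' 1 M'] {f : M → M'} {x : M}

theorem localRep_pullbackOneForm_eventuallyEq [I.Boundaryless] [I'.Boundaryless]
    [IsManifold I 1 M] (hf : ContMDiffAt I I' 1 f x)
    (θ : ∀ y : M', TangentSpace I' y →L[ℝ] ℝ) :
    localRep I (pullbackOneForm I I' f θ) x =ᶠ[𝓝 (extChartAt I x x)]
      pullbackOneForm 𝓘(ℝ, V) 𝓘(ℝ, V') (writtenInExtChartAt I I' x f)
        (localRep I' θ (f x)) := by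
  set e := extChartAt I x
  set e' := extChartAt I' (f x)
  have he : Filter.Tendsto e.symm (𝓝 (e x)) (𝓝 x) := by
    simpa [e, ContinuousAt] using continuousAt_extChartAt_symm (I := I) x
  have hsource : ∀ᶠ y in 𝓝 (e x), f (e.symm y) ∈ e'.source :=
    he (hf.continuousAt (extChartAt_source_mem_nhds (I := I') (f x)))
  filter_upwards [hsource.eventually_nhds, he ((contMDiffAt_iff_contMDiffAt_nhds (by simp)).1 hf),
    extChartAt_target_mem_nhds (I := I) x] with y hsource_y hf_y hy
  have hsymm : MDifferentiableAt 𝓘(ℝ, V) I e.symm y :=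
    ((contMDiffOn_extChartAt_symm (n := 1) x).contMDiffAt
      ((isOpen_extChartAt_target x).mem_nhds hy)).mdifferentiableAt one_ne_zero
  have hsymm' : MDifferentiableAt 𝓘(ℝ, V') I' e'.symm (e' (f (e.symm y))) :=
    ((contMDiffOn_extChartAt_symm (n := 1) (f x)).contMDiffAt ((isOpen_extChartAt_target _).mem_nhds
      (e'.map_source hsource_y.self_of_nhds))).mdifferentiableAt one_ne_zero
  have hchart' : MDifferentiableAt I' 𝓘(ℝ, V') e' (f (e.symm y)) :=
    mdifferentiableAt_extChartAt (by simpa [e'] using hsource_y.self_of_nhds)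
  have hf_y' : MDifferentiableAt I I' f (e.symm y) := hf_y.mdifferentiableAt one_ne_zero
  have hfactor : f ∘ e.symm =ᶠ[𝓝 y] e'.symm ∘ (e' ∘ f ∘ e.symm) :=
    hsource_y.mono fun y' hy' => (e'.left_inv hy').symm
  calc pullbackOneForm 𝓘(ℝ, V) I e.symm (pullbackOneForm I I' f θ) y
      = pullbackOneForm 𝓘(ℝ, V) I' (f ∘ e.symm) θ y :=
        (pullbackOneForm_comp hf_y' hsymm θ).symm
    _ = pullbackOneForm 𝓘(ℝ, V) I' (e'.symm ∘ (e' ∘ f ∘ e.symm)) θ y :=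
        pullbackOneForm_congr hfactor θ
    _ = pullbackOneForm 𝓘(ℝ, V) 𝓘(ℝ, V') (e' ∘ f ∘ e.symm) (localRep I' θ (f x)) y :=
        pullbackOneForm_comp (f := e' ∘ f ∘ e.symm) (g := e'.symm) hsymm'
          (hchart'.comp y (hf_y'.comp y hsymm)) θ

theorem mvfderiv_extChartAt_mfderiv [I.Boundaryless] [IsManifold I 1 M]
    (hf : MDifferentiableAt I I' f x) (u : TangentSpace I x) :
    mvfderiv I' (extChartAt I' (f x)) (f x) (mfderiv I I' f x u) =
      fderiv ℝ (writtenInExtChartAt I I' x f) (extChartAt I x x)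
        (mvfderiv I (extChartAt I x) x u) := by
  have hF : MDifferentiableAt 𝓘(ℝ, V) 𝓘(ℝ, V') (writtenInExtChartAt I I' x f)
      (extChartAt I x x) := by
    simpa [I.range_eq_univ, mdifferentiableAt_iff_differentiableAt, differentiableWithinAt_univ,
      writtenInExtChartAt] using hf.differentiableWithinAt_writtenInExtChartAt
  have hfactor : extChartAt I' (f x) ∘ f =ᶠ[𝓝 x]
      writtenInExtChartAt I I' x f ∘ extChartAt I x := by
    filter_upwards [extChartAt_source_mem_nhds (I := I) x] with y hy
    simp only [writtenInExtChartAt, Function.comp_apply, (extChartAt I x).left_inv hy]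
  have hchart := mdifferentiableAt_extChartAt (I := I) (mem_chart_source H x)
  have hchart' := mdifferentiableAt_extChartAt (I := I') (mem_chart_source H' (f x))
  have hleft := mfderiv_comp_apply x hchart' hf u
  have hright := mfderiv_comp_apply x hF hchart u
  rw [mfderiv_eq_fderiv] at hright
  exact hleft.symm.trans ((DFunLike.congr_fun hfactor.mfderiv_eq u).trans hright)

theorem dForm_pullbackOneForm [I.Boundaryless] [I'.Boundaryless] [IsManifold I 1 M]
    (hf : ContMDiffAt I I' 2 f x)
    {θ : ∀ y : M', TangentSpace I' y →L[ℝ] ℝ}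
    (hθ : DifferentiableAt ℝ (localRep I' θ (f x)) (extChartAt I' (f x) (f x))) :
    dForm I (pullbackOneForm I I' f θ) x = pullbackForm I I' f (dForm I' θ) x := by
  have hF : ContDiffAt ℝ 2 (writtenInExtChartAt I I' x f) (extChartAt I x x) := by
    simpa [I.range_eq_univ, writtenInExtChartAt, contDiffWithinAt_univ] using
      (contMDiffAt_iff.1 hf).2
  have hFx : writtenInExtChartAt I I' x f (extChartAt I x x) = extChartAt I' (f x) (f x) := by
    simp
  have hrep : localRep I (pullbackOneForm I I' f θ) x =ᶠ[𝓝 (extChartAt I x x)]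
      fun y => localRep I' θ (f x) (writtenInExtChartAt I I' x f y) ∘L
        fderiv ℝ (writtenInExtChartAt I I' x f) y := by
    filter_upwards [localRep_pullbackOneForm_eventuallyEq (hf.of_le one_le_two) θ] with y hy
    rw [hy, ← mfderiv_eq_fderiv]
    rfl
  have hchart := mvfderiv_extChartAt_mfderiv (hf.mdifferentiableAt two_ne_zero)
  ext u w
  simp only [dForm, pullbackForm, LinearMap.mk₂_apply, LinearMap.compl₁₂_apply,
    ContinuousLinearMap.coe_coe, hrep.fderiv_eq, hchart]
  rw [← hFx] at hθ ⊢
  exact fderiv_comp_fderiv_sub_swap hθ hF _ _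

theorem dForm_mfderiv_modelSpace [I'.Boundaryless] {f : V → M'} {z : V}
    (hf : ContMDiffAt 𝓘(ℝ, V) I' 2 f z)
    {θ : ∀ y : M', TangentSpace I' y →L[ℝ] ℝ}
    (hθ : DifferentiableAt ℝ (localRep I' θ (f z)) (extChartAt I' (f z) (f z)))
    {T : V → V →L[ℝ] ℝ} (hT : ∀ᶠ y in 𝓝 z, pullbackOneForm 𝓘(ℝ, V) I' f θ y = T y) (u w : V) :
    dForm I' θ (f z) (mfderiv 𝓘(ℝ, V) I' f z u) (mfderiv 𝓘(ℝ, V) I' f z w) =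
      fderiv ℝ T z u w - fderiv ℝ T z w u := by
  rw [← dForm_modelSpace, ← dForm_congr hT, dForm_pullbackOneForm hf hθ]
  rfl

end ExteriorDerivative

section NaturalCoordinates

theorem isInvertible_of_det_ne_zero {𝕜 V ι : Type*} [NontriviallyNormedField 𝕜] [CompleteSpace 𝕜]
    [NormedAddCommGroup V] [NormedSpace 𝕜 V] [Fintype ι] [DecidableEq ι] (b : Module.Basis ι 𝕜 V)
    {B : V →L[𝕜] V →L[𝕜] 𝕜} (hB : (Matrix.of fun i j => B (b i) (b j)).det ≠ 0) :
    B.IsInvertible := by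
  have : FiniteDimensional 𝕜 V := b.finiteDimensional_of_finite
  have hnondeg : B.toBilinForm.Nondegenerate := by
    refine LinearMap.BilinForm.nondegenerate_of_det_ne_zero _ b ?_
    convert hB
    ext i j
    simp
  exact ⟨((B.toBilinForm.toDual hnondeg).trans
    LinearMap.toContinuousLinearMap).toContinuousLinearEquiv, rfl⟩

variable {F : Type*} [NormedAddCommGroup F] [NormedSpace ℝ F]

/-- The Legendre covector `(l - q̇ ∂l/∂q̇) dt + ∂l/∂q̇ dq` of a Lagrangian `l(t, q, q̇)` at
`z = ((t, q), q̇)`. -/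
def coordLegendre (l : (ℝ × F) × F → ℝ) (z : (ℝ × F) × F) : ℝ × F →L[ℝ] ℝ :=
  l z • .fst ℝ ℝ F + fderiv ℝ l z ∘L .inr ℝ (ℝ × F) F ∘L
    (.snd ℝ ℝ F - (ContinuousLinearMap.fst ℝ ℝ F).smulRight z.2)

/-- The Hessian of `l(t, q, q̇)` with respect to the velocities `q̇`. -/
def velHessian (l : (ℝ × F) × F → ℝ) (z : (ℝ × F) × F) : F →L[ℝ] F →L[ℝ] ℝ :=
  (ContinuousLinearMap.inr ℝ (ℝ × F) F).precomp ℝ ∘L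
    fderiv ℝ (fderiv ℝ l) z ∘L .inr ℝ (ℝ × F) F

theorem velHessian_apply (l : (ℝ × F) × F → ℝ) (z : (ℝ × F) × F) (c d : F) :
    velHessian l z c d = fderiv ℝ (fderiv ℝ l) z (0, c) (0, d) := rfl

/-- The generalised force `∂l/∂q - (∂_t + q̇ ∂_q) ∂l/∂q̇` of a Lagrangian `l(t, q, q̇)`: the
Euler–Lagrange equations read `velHessian l z q̈ = coordForce l z`. -/
def coordForce (l : (ℝ × F) × F → ℝ) (z : (ℝ × F) × F) : F →L[ℝ] ℝ :=
  fderiv ℝ l z ∘L .inl ℝ (ℝ × F) F ∘L .inr ℝ ℝ F -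
    fderiv ℝ (fderiv ℝ l) z ((1, z.2), 0) ∘L .inr ℝ (ℝ × F) F

theorem coordForce_apply (l : (ℝ × F) × F → ℝ) (z : (ℝ × F) × F) (d : F) :
    coordForce l z d = fderiv ℝ l z ((0, d), 0) -
      fderiv ℝ (fderiv ℝ l) z ((1, z.2), 0) (0, d) := rfl

/-- The Euler–Lagrange vector field `∂_t + q̇ ∂_q + q̈ ∂_q̇` of a Lagrangian `l(t, q, q̇)`. It is
meaningful where the velocity Hessian is invertible; elsewhere `ContinuousLinearMap.inverse` is
zero. -/
def coordField (l : (ℝ × F) × F → ℝ) (z : (ℝ × F) × F) : (ℝ × F) × F :=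
  ((1, z.2), (velHessian l z).inverse (coordForce l z))

variable {l : (ℝ × F) × F → ℝ} {z : (ℝ × F) × F}

theorem contDiffAt_coordLegendre {k m : WithTop ℕ∞} (hl : ContDiffAt ℝ k l z) (hmk : m + 1 ≤ k) :
    ContDiffAt ℝ m (coordLegendre l) z :=
  ((hl.of_le (le_self_add.trans hmk)).smul contDiffAt_const).add
    ((hl.fderiv_right hmk).clm_comp (contDiffAt_const.clm_comp
      (contDiffAt_const.sub (contDiffAt_const.smulRight contDiffAt_snd))))

theorem contDiffAt_coordField [CompleteSpace F] (hl : ContDiffAt ℝ ∞ l z)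
    (hH : (velHessian l z).IsInvertible) : ContDiffAt ℝ ∞ (coordField l) z := by
  have hd := hl.fderiv_right (m := ∞) (by simp)
  have hdd := hd.fderiv_right (m := ∞) (by simp)
  have hv : ContDiffAt ℝ ∞ (fun z : (ℝ × F) × F => ((1 : ℝ), z.2)) z :=
    contDiffAt_const.prodMk contDiffAt_snd
  have hhessian : ContDiffAt ℝ ∞ (velHessian l) z :=
    contDiffAt_const.clm_comp (hdd.clm_comp contDiffAt_const)
  have hforce : ContDiffAt ℝ ∞ (coordForce l) z :=
    (hd.clm_comp contDiffAt_const).sub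
      ((hdd.clm_apply (hv.prodMk contDiffAt_const)).clm_comp contDiffAt_const)
  exact hv.prodMk ((hH.contDiffAt_map_inverse.comp z hhessian).clm_apply hforce)

theorem fderiv_coordLegendre_apply (hl : ContDiffAt ℝ 2 l z) (u : (ℝ × F) × F) (d : ℝ × F) :
    fderiv ℝ (coordLegendre l) z u d = fderiv ℝ l z u * d.1 +
      fderiv ℝ (fderiv ℝ l) z u (0, d.2 - d.1 • z.2) - d.1 * fderiv ℝ l z (0, u.2) := by
  have hl' : HasFDerivAt l (fderiv ℝ l z) z := (hl.differentiableAt two_ne_zero).hasFDerivAt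
  have hdl : HasFDerivAt (fderiv ℝ l) (fderiv ℝ (fderiv ℝ l) z) z :=
    ((hl.fderiv_right (m := 1) (by norm_num)).differentiableAt one_ne_zero).hasFDerivAt
  have hshift : HasFDerivAt (fun y : (ℝ × F) × F => ((0 : ℝ × F), d.2 - d.1 • y.2))
      (-(d.1 • (ContinuousLinearMap.inr ℝ (ℝ × F) F ∘L .snd ℝ (ℝ × F) F))) z :=
    (((ContinuousLinearMap.hasFDerivAt _).const_smul d.1).const_sub (0, d.2)).congr_of_eventuallyEq
      (.of_forall fun y => by simp)
  have hLegendre : DifferentiableAt ℝ (coordLegendre l) z :=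
    (contDiffAt_coordLegendre (m := 1) hl (by norm_num)).differentiableAt one_ne_zero
  have hd := (hLegendre.hasFDerivAt.clm_apply (hasFDerivAt_const d z)).unique
    ((hl'.mul_const d.1).add (hdl.clm_apply hshift))
  have hdu : fderiv ℝ (coordLegendre l) z u d = d.1 * fderiv ℝ l z u +
      (-(d.1 * fderiv ℝ l z (0, u.2)) + fderiv ℝ (fderiv ℝ l) z u (0, d.2 - d.1 • z.2)) := by
    simpa using DFunLike.congr_fun hd u
  rw [hdu]
  ring

theorem coordLegendre_curl_vertical (hl : ContDiffAt ℝ 2 l z) (X : (ℝ × F) × F) (c : F) :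
    fderiv ℝ (coordLegendre l) z X 0 - fderiv ℝ (coordLegendre l) z (0, c) X.1 =
      -velHessian l z c (X.1.2 - X.1.1 • z.2) := by
  rw [fderiv_coordLegendre_apply hl (0, c) X.1, velHessian_apply, map_zero]
  ring

theorem coordLegendre_curl_secondOrder (hl : ContDiffAt ℝ 2 l z) (a : F) (W : (ℝ × F) × F) :
    fderiv ℝ (coordLegendre l) z ((1, z.2), a) W.1 -
        fderiv ℝ (coordLegendre l) z W (1, z.2) =
      velHessian l z a (W.1.2 - W.1.1 • z.2) - coordForce l z (W.1.2 - W.1.1 • z.2) := by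
  have hX : (((1 : ℝ), z.2), a) = (((1 : ℝ), z.2), (0 : F)) + (0, a) := by simp
  have hW : W = W.1.1 • (((1 : ℝ), z.2), (0 : F)) + ((0, W.1.2 - W.1.1 • z.2), 0) + (0, W.2) := by
    ext <;> simp
  have hlX := congrArg (fderiv ℝ l z) hX
  have hlW := congrArg (fderiv ℝ l z) hW
  have hddlX := congrArg (fun u => fderiv ℝ (fderiv ℝ l) z u (0, W.1.2 - W.1.1 • z.2)) hX
  have hzero : fderiv ℝ (fderiv ℝ l) z W (0, z.2 - (1 : ℝ) • z.2) = 0 := by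
    rw [one_smul, sub_self]
    exact map_zero _
  simp only [map_add, map_smul, smul_eq_mul, add_apply] at hlX hlW hddlX
  rw [fderiv_coordLegendre_apply hl, fderiv_coordLegendre_apply hl, velHessian_apply,
    coordForce_apply, hzero, hlX, hlW, hddlX]
  ring

theorem coordLegendre_curl_eq_zero_iff (hl : ContDiffAt ℝ 2 l z)
    (hH : (velHessian l z).IsInvertible) (X : (ℝ × F) × F) :
    ((∀ W : (ℝ × F) × F,
        fderiv ℝ (coordLegendre l) z X W.1 - fderiv ℝ (coordLegendre l) z W X.1 = 0) ∧
      X.1.1 = 1) ↔ X = coordField l z := by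
  constructor
  · rintro ⟨h, ht⟩
    have hq : X.1.2 = z.2 := by
      refine sub_eq_zero.1 ((map_eq_zero_iff _ hH.injective).1 ?_)
      ext c
      have hc := h (0, c)
      rw [coordLegendre_curl_vertical hl, neg_eq_zero, ht, one_smul] at hc
      exact (hl.isSymmSndFDerivAt (by simp) _ _).trans hc
    obtain ⟨⟨t, q⟩, a⟩ := X
    obtain ⟨rfl, rfl⟩ : t = 1 ∧ q = z.2 := ⟨ht, hq⟩
    have ha : velHessian l z a = coordForce l z := by
      ext d
      have hd := h ((0, d), 0)
      rw [coordLegendre_curl_secondOrder hl] at hd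
      simpa [sub_eq_zero] using hd
    rw [coordField, ← ha, hH.inverse_apply_self]
  · rintro rfl
    refine ⟨fun W => ?_, rfl⟩
    rw [coordField, coordLegendre_curl_secondOrder hl, hH.self_apply_inverse, sub_self]

/-- The function `p q̇ + τ - l(t, q, q̇)` of `((t, q), (τ, p), q̇)`, with `(τ, p)` regarded as a
covector. -/
def coordEnergy (l : (ℝ × F) × F → ℝ) (z : (ℝ × F) × (ℝ × F →L[ℝ] ℝ) × F) : ℝ :=
  z.2.1 (1, z.2.2) - l (z.1, z.2.2)

theorem contDiffAt_coordEnergy {m : WithTop ℕ∞} {z : (ℝ × F) × (ℝ × F →L[ℝ] ℝ) × F}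
    (hl : ContDiffAt ℝ m l (z.1, z.2.2)) : ContDiffAt ℝ m (coordEnergy l) z :=
  (contDiffAt_fst.snd'.clm_apply (contDiffAt_const.prodMk contDiffAt_snd.snd')).sub
    (hl.comp z (contDiffAt_fst.prodMk contDiffAt_snd.snd'))

theorem fderiv_coordEnergy_cov {z : (ℝ × F) × (ℝ × F →L[ℝ] ℝ) × F}
    (hl : DifferentiableAt ℝ l (z.1, z.2.2)) (a : ℝ × F →L[ℝ] ℝ) :
    fderiv ℝ (coordEnergy l) z (0, a, 0) = a (1, z.2.2) := by
  have hcov : HasFDerivAt (fun y : (ℝ × F) × (ℝ × F →L[ℝ] ℝ) × F => y.2.1) _ z :=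
    (hasFDerivAt_snd (𝕜 := ℝ)).fst
  have hvel : HasFDerivAt (fun y : (ℝ × F) × (ℝ × F →L[ℝ] ℝ) × F => y.2.2) _ z :=
    (hasFDerivAt_snd (𝕜 := ℝ)).snd
  have hjet : HasFDerivAt (fun y : (ℝ × F) × (ℝ × F →L[ℝ] ℝ) × F => (y.1, y.2.2)) _ z :=
    hasFDerivAt_fst.prodMk hvel
  have h : HasFDerivAt (coordEnergy l) _ z :=
    (hcov.clm_apply ((hasFDerivAt_const 1 z).prodMk hvel)).sub (hl.hasFDerivAt.comp z hjet)
  have hzero (f : ℝ × F →L[ℝ] ℝ) : f (0, 0) = 0 := map_zero f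
  have hzero' (f : (ℝ × F) × F →L[ℝ] ℝ) : f (0, 0) = 0 := map_zero f
  simp [h.fderiv, hzero, hzero']

end NaturalCoordinates

section Charts

theorem openPartialHomeomorph_mem_atlas {H M : Type*} [TopologicalSpace H]
    (c : ChartedSpaceCore H M) {e : PartialEquiv M H} (he : e ∈ c.atlas) :
    c.openPartialHomeomorph e he ∈ @atlas H _ M c.toTopologicalSpace c.toChartedSpace := by
  change _ ∈ ⋃ (f : PartialEquiv M H) (hf : f ∈ c.atlas), {c.openPartialHomeomorph f hf}
  simp only [mem_iUnion, mem_singleton_iff]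
  exact ⟨e, he, rfl⟩

variable {V W : Type*} [NormedAddCommGroup V] [NormedSpace ℝ V] [NormedAddCommGroup W]
  [NormedSpace ℝ W] {H H' : Type*} [TopologicalSpace H] [TopologicalSpace H']
  {I : ModelWithCorners ℝ V H} {I' : ModelWithCorners ℝ W H'} {M M' : Type*} [TopologicalSpace M]
  [ChartedSpace H M] [TopologicalSpace M'] [ChartedSpace H' M'] {m : WithTop ℕ∞}

theorem contMDiffAt_of_comp_chart_symm {c : OpenPartialHomeomorph M H}
    (hc : c ∈ IsManifold.maximalAtlas I m M) {z : H} (hz : z ∈ c.target) {h : M → M'}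
    (hh : ContMDiffAt I I' m (h ∘ c.symm) z) : ContMDiffAt I I' m h (c.symm z) := by
  have hs := c.map_target hz
  refine ((c.right_inv hz).symm ▸ hh : ContMDiffAt I I' m (h ∘ c.symm) (c (c.symm z))).comp _
    (contMDiffAt_of_mem_maximalAtlas hc hs) |>.congr_of_eventuallyEq ?_
  filter_upwards [c.open_source.mem_nhds hs] with x hx
  rw [Function.comp_apply, Function.comp_apply, c.left_inv hx]

section LinearReparametrisation
variable {V' : Type*} [NormedAddCommGroup V'] [NormedSpace ℝ V']

theorem mfderiv_comp_continuousLinearMap (A : V →L[ℝ] V') {g : V' → M'} {z : V}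
    (hg : MDifferentiableAt 𝓘(ℝ, V') I' g (A z)) (u : V) :
    mfderiv 𝓘(ℝ, V) I' (g ∘ A) z u = mfderiv 𝓘(ℝ, V') I' g (A z) (A u) := by
  refine (mfderiv_comp_apply z hg A.mdifferentiableAt u).trans ?_
  rw [A.hasMFDerivAt.mfderiv]
  rfl

theorem mfderiv_comp_const_add_continuousLinearMap (A : V →L[ℝ] V') {g : V' → M'} {z : V'}
    (hg : MDifferentiableAt 𝓘(ℝ, V') I' g z) (u : V) :
    mfderiv 𝓘(ℝ, V) I' (g ∘ fun w => z + A w) 0 u = mfderiv 𝓘(ℝ, V') I' g z (A u) := by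
  have hA : HasMFDerivAt 𝓘(ℝ, V) 𝓘(ℝ, V') (fun w => z + A w) 0 A :=
    (A.hasFDerivAt.const_add z).hasMFDerivAt
  have hg' (y : V') (hy : y = z) :
      HasMFDerivAt 𝓘(ℝ, V') I' g y (mfderiv 𝓘(ℝ, V') I' g z : V' →L[ℝ] W) := by
    subst hy
    exact hg.hasMFDerivAt
  exact DFunLike.congr_fun ((hg' (z + A 0) (by rw [map_zero, add_zero])).comp 0 hA).mfderiv u

end LinearReparametrisation

variable {M : Type*} [TopologicalSpace M] [ChartedSpace V M]

/-- The tangent vector at `c⁻¹ z` whose components in the chart `c` are given. -/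
def ofCoord (c : OpenPartialHomeomorph M V) (z : V) : V →L[ℝ] TangentSpace 𝓘(ℝ, V) (c.symm z) :=
  mfderiv 𝓘(ℝ, V) 𝓘(ℝ, V) c.symm z

variable {c : OpenPartialHomeomorph M V} (hc : c ∈ IsManifold.maximalAtlas 𝓘(ℝ, V) ∞ M) {z : V}
  (hz : z ∈ c.target)
include hc hz

theorem ofCoord_bijective : Function.Bijective (ofCoord c z) := by
  have hdiff : c.MDifferentiable 𝓘(ℝ, V) 𝓘(ℝ, V) :=
    ⟨(contMDiffOn_of_mem_maximalAtlas hc).mdifferentiableOn (by simp),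
      (contMDiffOn_symm_of_mem_maximalAtlas hc).mdifferentiableOn (by simp)⟩
  exact hdiff.symm.mfderiv_bijective hz

theorem mfderiv_ofCoord {f : M → M'} (hf : MDifferentiableAt 𝓘(ℝ, V) I' f (c.symm z)) (u : V) :
    mfderiv 𝓘(ℝ, V) I' f (c.symm z) (ofCoord c z u) = mfderiv 𝓘(ℝ, V) I' (f ∘ c.symm) z u :=
  (mfderiv_comp_apply z hf
    ((contMDiffAt_symm_of_mem_maximalAtlas hc hz).mdifferentiableAt (by simp)) u).symm

theorem mvfderiv_ofCoord {f : M → ℝ} (hf : MDifferentiableAt 𝓘(ℝ, V) 𝓘(ℝ, ℝ) f (c.symm z))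
    (u : V) : mvfderiv 𝓘(ℝ, V) f (c.symm z) (ofCoord c z u) = fderiv ℝ (f ∘ c.symm) z u := by
  rw [← mfderiv_eq_fderiv]
  exact mfderiv_ofCoord hc hz hf u

theorem contMDiffAt_vectorField_of_ofCoord [IsManifold 𝓘(ℝ, V) 1 M]
    {X : ∀ x : M, TangentSpace 𝓘(ℝ, V) x} {g : V → V} (hg : ContDiffAt ℝ ∞ g z)
    (hX : ∀ y ∈ c.target, X (c.symm y) = ofCoord c y (g y)) :
    ContMDiffAt 𝓘(ℝ, V) 𝓘(ℝ, V).tangent ∞ (fun x => (⟨x, X x⟩ : TangentBundle 𝓘(ℝ, V) M))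
      (c.symm z) := by
  let G : V → TangentBundle 𝓘(ℝ, V) V := fun y => ⟨y, g y⟩
  have hG : ContMDiffAt 𝓘(ℝ, V) 𝓘(ℝ, V).tangent ∞ G z :=
    contMDiffAt_vectorSpace_iff_contDiffAt.2 hg
  have htangent := ((contMDiffOn_symm_of_mem_maximalAtlas hc).contMDiffOn_tangentMapWithin (m := ∞)
    (by simp) c.open_target.uniqueMDiffOn).contMDiffAt (x := G z) ((c.open_target.preimage
      (FiberBundle.continuous_proj V (TangentSpace 𝓘(ℝ, V)))).mem_nhds hz)
  refine contMDiffAt_of_comp_chart_symm hc hz ((htangent.comp z hG).congr_of_eventuallyEq ?_)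
  filter_upwards [c.open_target.mem_nhds hz] with y hy
  refine .trans ?_ (tangentMapWithin_eq_tangentMap (p := G y) (c.open_target.uniqueMDiffOn y hy)
    ((contMDiffAt_symm_of_mem_maximalAtlas hc hy).mdifferentiableAt (by simp))).symm
  exact congrArg (Bundle.TotalSpace.mk (c.symm y)) (hX y hy)

end Charts

section Jets
variable {n : ℕ} {E : Type u} [TopologicalSpace E] [ChartedSpace (EMod n) E] {π : E → ℝ}

theorem contMDiff_bundleProj [IsFibreBundle n π] : ContMDiff 𝓘(ℝ, EMod n) 𝓘(ℝ, ℝ) ∞ π := by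
  intro x
  obtain ⟨φ, hφ, hx⟩ := exists_bundleChart (n := n) π x
  have hφx := φ.open_source.mem_nhds hx
  exact (((ContinuousLinearMap.fst ℝ ℝ (Fib n)).contMDiff.contMDiffAt.comp x
    (hφ.smooth.contMDiffAt hφx)).congr_of_eventuallyEq
      (Filter.eventuallyEq_of_mem hφx fun y hy => (hφ.fst_eq y hy).symm))

variable [IsFibreBundle n π] {φ : OpenPartialHomeomorph E (EMod n)} (hφ : IsBundleChart π φ)

/-- The chart `J1.chart φ hφ`, with coordinates `(t, q, q̇)`, as an open partial homeomorphism. -/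
def J1.natChart : OpenPartialHomeomorph (J1 n π) (EMod n × Fib n) :=
  (J1.core n π).openPartialHomeomorph (J1.chart φ hφ) ⟨φ, hφ, rfl⟩

theorem J1.natChart_mem_maximalAtlas :
    J1.natChart hφ ∈ IsManifold.maximalAtlas (IJ n) ∞ (J1 n π) :=
  IsManifold.subset_maximalAtlas (openPartialHomeomorph_mem_atlas (J1.core n π) ⟨φ, hφ, rfl⟩)

theorem J1.exists_natChart_symm_eq (v : J1 n π) :
    ∃ (φ : OpenPartialHomeomorph E (EMod n)) (hφ : IsBundleChart π φ),
      ∃ z ∈ (J1.natChart hφ).target, (J1.natChart hφ).symm z = v := by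
  obtain ⟨φ, hφ, hv⟩ := exists_bundleChart (n := n) π v.pt
  exact ⟨φ, hφ, _, (J1.natChart hφ).map_source hv, (J1.natChart hφ).left_inv hv⟩

theorem natChart_vshift {v : J1 n π} (hv : v.pt ∈ φ.source)
    (w : TangentSpace 𝓘(ℝ, EMod n) v.pt) :
    J1.natChart hφ (vshift v w) = J1.natChart hφ v +
      (0, (toMod φ v.pt w).2 - (toMod φ v.pt w).1 • (J1.natChart hφ v).2) := by
  refine Prod.ext (add_zero _).symm ?_
  change (toMod φ v.pt (v.vel + (w - mvfderiv 𝓘(ℝ, EMod n) π v.pt w • v.vel))).2 = _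
  rw [map_add, map_sub, map_smul, hφ.dt_eq hv]
  rfl

variable {z : EMod n × Fib n} (hz : z ∈ (J1.natChart hφ).target)
include hz

theorem J1.vel_natChart_symm : ((J1.natChart hφ).symm z).vel = fromMod φ z.1 (1, z.2) :=
  J1.ofVec_fromMod hφ hz.1 z.2

theorem J1.contMDiffAt_natChart_symm : ContMDiffAt (IJ n) (IJ n) ∞ (J1.natChart hφ).symm z :=
  contMDiffAt_symm_of_mem_maximalAtlas (J1.natChart_mem_maximalAtlas hφ) hz

theorem vlift_fromMod (u : EMod n) :
    vlift ((J1.natChart hφ).symm z) (fromMod φ z.1 u) =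
      ofCoord (J1.natChart hφ) z (0, u.2 - u.1 • z.2) := by
  set v := (J1.natChart hφ).symm z with hv
  have hvpt : v.pt ∈ φ.source := φ.map_target hz.1
  let B : EMod n →L[ℝ] EMod n × Fib n := .inr ℝ (EMod n) (Fib n) ∘L
    (.snd ℝ ℝ (Fib n) - (ContinuousLinearMap.fst ℝ ℝ (Fib n)).smulRight z.2) ∘L toMod φ v.pt
  have hshift : (fun w : EMod n => vshift v w) = (J1.natChart hφ).symm ∘ fun w => z + B w := by
    funext w
    refine ((J1.natChart hφ).left_inv (x := vshift v w) hvpt).symm.trans (congrArg _ ?_)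
    refine (natChart_vshift hφ hvpt w).trans ?_
    rw [hv, (J1.natChart hφ).right_inv hz]
    rfl
  have hBu : B (fromMod φ z.1 u) = (0, u.2 - u.1 • z.2) := by
    change ((0 : EMod n), (toMod φ (φ.symm z.1) (fromMod φ z.1 u)).2 -
      (toMod φ (φ.symm z.1) (fromMod φ z.1 u)).1 • z.2) = _
    rw [hφ.toMod_fromMod hz.1]
  rw [← hBu, vlift, hshift]
  exact mfderiv_comp_const_add_continuousLinearMap B
    ((J1.contMDiffAt_natChart_symm hφ hz).mdifferentiableAt (by simp)) _

omit hz in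
theorem vlift_vel (v : J1 n π) : vlift v v.vel = 0 := by
  obtain ⟨φ, hφ, z, hz, rfl⟩ := J1.exists_natChart_symm_eq v
  rw [J1.vel_natChart_symm hφ hz, vlift_fromMod hφ hz, one_smul, sub_self]
  exact map_zero _

theorem legendreCov_fromMod {L : J1 n π → ℝ} (hL : ContMDiff (IJ n) 𝓘(ℝ, ℝ) ∞ L) (u : EMod n) :
    legendreCov L ((J1.natChart hφ).symm z) (fromMod φ z.1 u) =
      coordLegendre (L ∘ (J1.natChart hφ).symm) z u := by
  change L _ * mvfderiv 𝓘(ℝ, EMod n) π (φ.symm z.1) (fromMod φ z.1 u) +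
    mvfderiv (IJ n) L _ (vlift _ (fromMod φ z.1 u)) = _
  rw [vlift_fromMod hφ hz, mvfderiv_ofCoord (J1.natChart_mem_maximalAtlas hφ) hz
    (hL.mdifferentiableAt (by simp)), hφ.dt_eq (φ.map_target hz.1), hφ.toMod_fromMod hz.1]
  rfl

section Hessian
variable {L : J1 n π → ℝ} (hL : ContMDiff (IJ n) 𝓘(ℝ, ℝ) ∞ L)
include hL

theorem contDiffAt_comp_natChart_symm :
    ContDiffAt ℝ ∞ (L ∘ (J1.natChart hφ).symm) z :=
  (hL.contMDiffAt.comp z (J1.contMDiffAt_natChart_symm hφ hz)).contDiffAt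

theorem hessian_natChart_symm (A B : Fin n) :
    hessian L φ hφ ((J1.natChart hφ).symm z) A B = velHessian (L ∘ (J1.natChart hφ).symm) z
      (EuclideanSpace.single A 1) (EuclideanSpace.single B 1) := by
  set l := L ∘ (J1.natChart hφ).symm
  have hfiber (w : Fib n) : HasFDerivAt (fun w' : Fib n => (z.1, w'))
      (ContinuousLinearMap.inr ℝ (EMod n) (Fib n)) w := hasFDerivAt_prodMk_right _ _
  have hfirst (w c : Fib n) :
      fderiv ℝ (fun w' => l (z.1, w')) w c = fderiv ℝ l (z.1, w) (0, c) := by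
    have hl := contDiffAt_comp_natChart_symm hφ (z := (z.1, w)) ⟨hz.1, mem_univ _⟩ hL
    exact DFunLike.congr_fun
      ((hl.differentiableAt (by simp)).hasFDerivAt.comp w (hfiber w)).fderiv c
  have hsecond : HasFDerivAt (fun w => fderiv ℝ l (z.1, w)) _ z.2 :=
    (((contDiffAt_comp_natChart_symm hφ hz hL).fderiv_right (m := ∞) (by simp)).differentiableAt
      (by simp)).hasFDerivAt.comp (x := z.2) (f := fun w' : Fib n => (z.1, w')) (hfiber z.2)
  have happly := (hsecond.clm_apply (hasFDerivAt_const
    ((0, EuclideanSpace.single B 1) : EMod n × Fib n) z.2)).fderiv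
  have hz' : J1.natChart hφ ((J1.natChart hφ).symm z) = z := (J1.natChart hφ).right_inv hz
  have hpt : φ (φ.symm z.1) = z.1 := φ.right_inv hz.1
  change fderiv ℝ (fun w => fderiv ℝ (fun w' => l (φ (φ.symm z.1), w')) w
    (EuclideanSpace.single B 1)) (J1.natChart hφ ((J1.natChart hφ).symm z)).2
      (EuclideanSpace.single A 1) = _
  simp only [hz', hpt, hfirst]
  rw [happly]
  simp [velHessian_apply, l]

theorem velHessian_isInvertible (hreg : IsRegular L) :
    (velHessian (L ∘ (J1.natChart hφ).symm) z).IsInvertible := by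
  refine isInvertible_of_det_ne_zero (EuclideanSpace.basisFun (Fin n) ℝ).toBasis ?_
  refine ne_of_eq_of_ne (congrArg Matrix.det ?_) (hreg φ hφ ((J1.natChart hφ).symm z)
    (φ.map_target hz.1))
  ext A B
  rw [hessian_natChart_symm hφ hz hL]
  simp

end Hessian

variable [IsManifold 𝓘(ℝ, EMod n) ∞ E]

theorem J1.mfderiv_pt_ofCoord (u : EMod n × Fib n) :
    mfderiv (IJ n) 𝓘(ℝ, EMod n) J1.pt ((J1.natChart hφ).symm z) (ofCoord (J1.natChart hφ) z u) =
      fromMod φ z.1 u.1 :=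
  (mfderiv_ofCoord (J1.natChart_mem_maximalAtlas hφ) hz
    (contMDiff_pt.mdifferentiableAt (by simp)) u).trans
    (mfderiv_comp_continuousLinearMap (.fst ℝ (EMod n) (Fib n))
      (hφ.mdiff.symm.mdifferentiableAt hz.1) u)

omit hz in
theorem etaJ_apply (v : J1 n π) (ξ : TangentSpace (IJ n) v) :
    etaJ v ξ = mvfderiv 𝓘(ℝ, EMod n) π v.pt (mfderiv (IJ n) 𝓘(ℝ, EMod n) J1.pt v ξ) :=
  mfderiv_comp_apply v (contMDiff_bundleProj.mdifferentiableAt (by simp))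
    (contMDiff_pt.mdifferentiableAt (by simp)) ξ

theorem etaJ_ofCoord (u : EMod n × Fib n) :
    etaJ ((J1.natChart hφ).symm z) (ofCoord (J1.natChart hφ) z u) = u.1.1 := by
  rw [etaJ_apply, J1.mfderiv_pt_ofCoord hφ hz]
  exact (hφ.dt_eq (φ.map_target hz.1) _).trans (congrArg Prod.fst (hφ.toMod_fromMod hz.1 u.1))

end Jets

section Cotangent
variable {n : ℕ} {E : Type u} [TopologicalSpace E] [ChartedSpace (EMod n) E]
  [IsManifold 𝓘(ℝ, EMod n) ∞ E]

theorem pullbackOneForm_liouville {V H M : Type*} [NormedAddCommGroup V] [NormedSpace ℝ V]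
    [TopologicalSpace H] {I : ModelWithCorners ℝ V H} [TopologicalSpace M] [ChartedSpace H M]
    {f : M → CotBundle n E} {x : M} (hf : MDifferentiableAt I (ICot n) f x) :
    pullbackOneForm I (ICot n) f liouville x =
      (f x).2 ∘L mfderiv I 𝓘(ℝ, EMod n) (Bundle.TotalSpace.proj ∘ f) x :=
  congrArg (fun A => (f x).2 ∘L A) (mfderiv_comp (I' := ICot n) (I'' := 𝓘(ℝ, EMod n)) x
    ((Bundle.contMDiff_proj (n := 1) _).mdifferentiableAt (by simp)) hf).symm

theorem inCoordinates_cotangent_apply (x₀ x : E) (α : TangentSpace 𝓘(ℝ, EMod n) x →L[ℝ] ℝ)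
    (u : EMod n) :
    ContinuousLinearMap.inCoordinates (EMod n) (TangentSpace 𝓘(ℝ, EMod n)) ℝ
      (Bundle.Trivial E ℝ) x₀ x x₀ x α u =
      α ((trivializationAt (EMod n) (TangentSpace 𝓘(ℝ, EMod n)) x₀).symmL ℝ x u) := by
  rw [ContinuousLinearMap.inCoordinates,
    show (trivializationAt ℝ (Bundle.Trivial E ℝ) x₀).continuousLinearMapAt ℝ x = .id ℝ ℝ from
      Bundle.Trivial.continuousLinearMapAt_trivialization ℝ E ℝ x]
  rfl

variable (α : CotBundle n E)

theorem extChartAt_cotangent_fst (β : CotBundle n E) :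
    (extChartAt (ICot n) α β).1 = extChartAt 𝓘(ℝ, EMod n) α.proj β.proj := by
  rw [FiberBundle.extChartAt]
  rfl

theorem extChartAt_cotangent_snd {β : CotBundle n E}
    (hβ : β.proj ∈ (chartAt (EMod n) α.proj).source) (w : TangentSpace 𝓘(ℝ, EMod n) β.proj) :
    (extChartAt (ICot n) α β).2
      (mfderiv 𝓘(ℝ, EMod n) 𝓘(ℝ, EMod n) (extChartAt 𝓘(ℝ, EMod n) α.proj) β.proj w) = β.2 w := by
  have : IsManifold 𝓘(ℝ, EMod n) 1 E := IsManifold.of_le (n := ∞) (by simp)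
  rw [← TangentBundle.continuousLinearMapAt_trivializationAt hβ, FiberBundle.extChartAt]
  exact (inCoordinates_cotangent_apply α.proj β.proj β.2 _).trans
    (congrArg β.2 (Bundle.Trivialization.symmL_continuousLinearMapAt _ hβ w))

theorem proj_mem_chart_source_of_mem_extChartAt_source {β : CotBundle n E}
    (hβ : β ∈ (extChartAt (ICot n) α).source) : β.proj ∈ (chartAt (EMod n) α.proj).source := by
  rw [FiberBundle.extChartAt] at hβ
  simpa using hβ.1

theorem localRep_liouville {y : EMod n × (EMod n →L[ℝ] ℝ)}
    (hy : y ∈ (extChartAt (ICot n) α).target) :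
    localRep (ICot n) liouville α y = y.2 ∘L .fst ℝ (EMod n) (EMod n →L[ℝ] ℝ) := by
  have : IsManifold 𝓘(ℝ, EMod n) 1 E := IsManifold.of_le (n := ∞) (by simp)
  set e := extChartAt (ICot n) α
  set c := extChartAt 𝓘(ℝ, EMod n) α.proj
  have hopen := isOpen_extChartAt_target (I := ICot n) α
  have hsrc := proj_mem_chart_source_of_mem_extChartAt_source α (e.map_target hy)
  have hfst : (c ∘ (Bundle.TotalSpace.proj ∘ e.symm)) =ᶠ[𝓝 y] Prod.fst := by
    filter_upwards [hopen.mem_nhds hy] with y' hy'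
    exact (extChartAt_cotangent_fst α _).symm.trans (congrArg Prod.fst (e.right_inv hy'))
  have hsymm : MDifferentiableAt 𝓘(ℝ, EMod n × (EMod n →L[ℝ] ℝ)) (ICot n) e.symm y :=
    ((contMDiffOn_extChartAt_symm (n := ∞) α).contMDiffAt (hopen.mem_nhds hy)).mdifferentiableAt
      (by simp)
  have hproj : MDifferentiableAt (ICot n) 𝓘(ℝ, EMod n) Bundle.TotalSpace.proj (e.symm y) :=
    (Bundle.contMDiff_proj (n := 1) _).mdifferentiableAt (by simp)
  have hchain (u : EMod n × (EMod n →L[ℝ] ℝ)) :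
      mfderiv 𝓘(ℝ, EMod n) 𝓘(ℝ, EMod n) c (e.symm y).proj
        (mfderiv (ICot n) 𝓘(ℝ, EMod n) Bundle.TotalSpace.proj (e.symm y)
          (mfderiv 𝓘(ℝ, EMod n × (EMod n →L[ℝ] ℝ)) (ICot n) e.symm y u)) = u.1 := by
    refine .trans (.symm ?_) (DFunLike.congr_fun (hfst.mfderiv_eq.trans
      (ContinuousLinearMap.fst ℝ (EMod n) (EMod n →L[ℝ] ℝ)).hasMFDerivAt.mfderiv) u)
    exact (mfderiv_comp_apply y (mdifferentiableAt_extChartAt hsrc) (hproj.comp y hsymm) u).trans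
      (congrArg _ (mfderiv_comp_apply y hproj hsymm u))
  refine ContinuousLinearMap.ext fun u => ?_
  refine (extChartAt_cotangent_snd α hsrc _).symm.trans ?_
  exact congrArg₂ (fun (a : EMod n →L[ℝ] ℝ) b => a b)
    (congrArg Prod.snd (e.right_inv hy)) (hchain u)

theorem differentiableAt_localRep_liouville :
    DifferentiableAt ℝ (localRep (ICot n) liouville α) (extChartAt (ICot n) α α) := by
  refine DifferentiableAt.congr_of_eventuallyEq (f := fun y : EMod n × (EMod n →L[ℝ] ℝ) =>
    y.2 ∘L .fst ℝ (EMod n) (EMod n →L[ℝ] ℝ)) (by fun_prop) ?_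
  filter_upwards [(isOpen_extChartAt_target (I := ICot n) α).mem_nhds
    (mem_extChartAt_target (I := ICot n) α)] with y hy
  exact localRep_liouville α hy

omit α in
theorem contMDiffAt_covector_comp_toMod {π : E → ℝ} {φ : OpenPartialHomeomorph E (EMod n)}
    (hφ : IsBundleChart π φ) {y : EMod n × (EMod n →L[ℝ] ℝ)} (hy : y.1 ∈ φ.target) :
    ContMDiffAt 𝓘(ℝ, EMod n × (EMod n →L[ℝ] ℝ)) (ICot n) ∞
      (fun z => (⟨φ.symm z.1, z.2 ∘L toMod φ (φ.symm z.1)⟩ : CotBundle n E)) y := by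
  have : IsManifold 𝓘(ℝ, EMod n) 1 E := IsManifold.of_le (n := ∞) (by simp)
  have hbase : ContMDiffAt 𝓘(ℝ, EMod n × (EMod n →L[ℝ] ℝ)) 𝓘(ℝ, EMod n) ∞
      (fun z : EMod n × (EMod n →L[ℝ] ℝ) => φ.symm z.1) y :=
    (hφ.smooth_symm.contMDiffAt (φ.open_target.mem_nhds hy)).comp y
      contDiff_fst.contMDiff.contMDiffAt
  have hderiv := ((hφ.smooth.contMDiffAt (φ.open_source.mem_nhds (φ.map_target hy))).mfderiv_const
    (m := ∞) (by simp)).comp y hbase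
  have hcov : ContMDiffAt 𝓘(ℝ, EMod n × (EMod n →L[ℝ] ℝ)) 𝓘(ℝ, EMod n →L[ℝ] ℝ) ∞
      (fun z : EMod n × (EMod n →L[ℝ] ℝ) => z.2) y := contDiff_snd.contMDiff.contMDiffAt
  rw [contMDiffAt_hom_bundle]
  refine ⟨hbase, (hcov.clm_comp hderiv).congr_of_eventuallyEq (.of_forall fun z => ?_)⟩
  refine ContinuousLinearMap.ext fun u => ?_
  rw [inCoordinates_cotangent_apply]
  change z.2 (toMod φ (φ.symm z.1) _) = z.2 (ContinuousLinearMap.inCoordinates (EMod n)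
    (TangentSpace 𝓘(ℝ, EMod n)) (EMod n) (TangentSpace 𝓘(ℝ, EMod n)) _ _ _ _ _ u)
  rw [ContinuousLinearMap.inCoordinates, TangentBundle.continuousLinearMapAt_model_space]
  rfl

end Cotangent

section MixedBundle
variable {n : ℕ}

/-- The projection `(x, a, q̇) ↦ (x, a)`, which represents `pr1` in natural coordinates. -/
def coordPr1 : PMod n →L[ℝ] EMod n × (EMod n →L[ℝ] ℝ) :=
  (ContinuousLinearMap.fst ℝ _ _).prod (.fst ℝ _ _ ∘L .snd ℝ _ _)

/-- The projection `(x, a, q̇) ↦ (x, q̇)`, which represents `pr2` in natural coordinates. -/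
def coordPr2 : PMod n →L[ℝ] EMod n × Fib n :=
  (ContinuousLinearMap.fst ℝ _ _).prod (.snd ℝ _ _ ∘L .snd ℝ _ _)

variable {E : Type u} [TopologicalSpace E] [ChartedSpace (EMod n) E]
  {π : E → ℝ} [IsFibreBundle n π]
  {φ : OpenPartialHomeomorph E (EMod n)} (hφ : IsBundleChart π φ)

/-- The chart `Mixed.chart φ hφ` as an open partial homeomorphism. -/
def Mixed.natChart : OpenPartialHomeomorph (Mixed n π) (PMod n) :=
  (Mixed.core n π).openPartialHomeomorph (Mixed.chart φ hφ) ⟨φ, hφ, rfl⟩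

theorem Mixed.natChart_mem_maximalAtlas :
    Mixed.natChart hφ ∈ IsManifold.maximalAtlas (IP n) ∞ (Mixed n π) :=
  IsManifold.subset_maximalAtlas
    (openPartialHomeomorph_mem_atlas (Mixed.core n π) ⟨φ, hφ, rfl⟩)

theorem Mixed.exists_natChart_symm_eq (p : Mixed n π) :
    ∃ (φ : OpenPartialHomeomorph E (EMod n)) (hφ : IsBundleChart π φ),
      ∃ z ∈ (Mixed.natChart hφ).target, (Mixed.natChart hφ).symm z = p := by
  obtain ⟨φ, hφ, hp⟩ := exists_bundleChart (n := n) π p.jet.pt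
  exact ⟨φ, hφ, _, (Mixed.natChart hφ).map_source hp, (Mixed.natChart hφ).left_inv hp⟩

theorem contMDiff_pr2 : ContMDiff (IP n) (IJ n) ∞ (pr2 : Mixed n π → J1 n π) := by
  intro p
  obtain ⟨φ, hφ, z, hz, rfl⟩ := Mixed.exists_natChart_symm_eq p
  exact contMDiffAt_of_comp_chart_symm (Mixed.natChart_mem_maximalAtlas hφ) hz
    ((J1.contMDiffAt_natChart_symm hφ (z := coordPr2 z) ⟨hz.1, mem_univ _⟩).comp z
      coordPr2.contMDiff.contMDiffAt)

section Coordinates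
variable {z : PMod n} (hz : z ∈ (Mixed.natChart hφ).target)
include hz

theorem mfderiv_pr2_ofCoord (u : PMod n) :
    mfderiv (IP n) (IJ n) pr2 ((Mixed.natChart hφ).symm z) (ofCoord (Mixed.natChart hφ) z u) =
      ofCoord (J1.natChart hφ) (coordPr2 z) (coordPr2 u) :=
  (mfderiv_ofCoord (Mixed.natChart_mem_maximalAtlas hφ) hz
    (contMDiff_pr2.mdifferentiableAt (by simp)) u).trans
    (mfderiv_comp_continuousLinearMap coordPr2 ((J1.contMDiffAt_natChart_symm hφ
      (z := coordPr2 z) ⟨hz.1, mem_univ _⟩).mdifferentiableAt (by simp)) u)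

variable (L : J1 n π → ℝ)

theorem energy_natChart_symm :
    energy L ((Mixed.natChart hφ).symm z) = coordEnergy (L ∘ (J1.natChart hφ).symm) z := by
  refine congrArg (· - _) ?_
  change z.2.1 (toMod φ (φ.symm z.1) ((J1.natChart hφ).symm (coordPr2 z)).vel) = _
  rw [J1.vel_natChart_symm hφ (z := coordPr2 z) ⟨hz.1, mem_univ _⟩]
  exact congrArg z.2.1 (hφ.toMod_fromMod hz.1 _)

theorem energy_comp_natChart_symm :
    energy L ∘ (Mixed.natChart hφ).symm =ᶠ[𝓝 z] coordEnergy (L ∘ (J1.natChart hφ).symm) :=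
  Filter.mem_of_superset ((Mixed.natChart hφ).open_target.mem_nhds hz)
    fun _ hy => energy_natChart_symm hφ hy L

variable {L} (hL : ContMDiff (IJ n) 𝓘(ℝ, ℝ) ∞ L)
include hL

omit hz in
theorem contMDiff_energy : ContMDiff (IP n) 𝓘(ℝ, ℝ) ∞ (energy L : Mixed n π → ℝ) := by
  intro p
  obtain ⟨φ, hφ, z, hz, rfl⟩ := Mixed.exists_natChart_symm_eq p
  exact contMDiffAt_of_comp_chart_symm (Mixed.natChart_mem_maximalAtlas hφ) hz
    ((contDiffAt_coordEnergy (contDiffAt_comp_natChart_symm hφ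
      ⟨hz.1, mem_univ _⟩ hL)).contMDiffAt.congr_of_eventuallyEq (energy_comp_natChart_symm hφ hz L))

theorem mvfderiv_energy_ofCoord (a : EMod n →L[ℝ] ℝ) :
    mvfderiv (IP n) (energy L) ((Mixed.natChart hφ).symm z)
      (ofCoord (Mixed.natChart hφ) z (0, a, 0)) = a (1, z.2.2) := by
  rw [mvfderiv_ofCoord (Mixed.natChart_mem_maximalAtlas hφ) hz
    ((contMDiff_energy hL).mdifferentiableAt (by simp)),
    (energy_comp_natChart_symm hφ hz L).fderiv_eq]
  exact fderiv_coordEnergy_cov ((contDiffAt_comp_natChart_symm hφ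
    (z := coordPr2 z) ⟨hz.1, mem_univ _⟩ hL).differentiableAt (by simp)) a

end Coordinates

variable [IsManifold 𝓘(ℝ, EMod n) ∞ E]

theorem contMDiff_pr1 : ContMDiff (IP n) (ICot n) ∞ (pr1 : Mixed n π → CotBundle n E) := by
  intro p
  obtain ⟨φ, hφ, z, hz, rfl⟩ := Mixed.exists_natChart_symm_eq p
  exact contMDiffAt_of_comp_chart_symm (Mixed.natChart_mem_maximalAtlas hφ) hz
    ((contMDiffAt_covector_comp_toMod hφ (y := coordPr1 z) hz.1).comp z
      coordPr1.contMDiff.contMDiffAt)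

theorem eta_apply (p : Mixed n π) (Z : TangentSpace (IP n) p) :
    eta p Z = etaJ (pr2 p) (mfderiv (IP n) (IJ n) pr2 p Z) :=
  mfderiv_comp_apply p
    ((contMDiff_bundleProj.comp contMDiff_pt).mdifferentiableAt (by simp))
    (contMDiff_pr2.mdifferentiableAt (by simp)) Z

variable {z : PMod n} (hz : z ∈ (Mixed.natChart hφ).target)
include hz

theorem eta_ofCoord (u : PMod n) :
    eta ((Mixed.natChart hφ).symm z) (ofCoord (Mixed.natChart hφ) z u) = u.1.1 := by
  rw [eta_apply, mfderiv_pr2_ofCoord hφ hz]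
  exact etaJ_ofCoord hφ (z := coordPr2 z) ⟨hz.1, mem_univ _⟩ (coordPr2 u)

theorem pullbackOneForm_pr1_natChart_symm :
    pullbackOneForm 𝓘(ℝ, PMod n) (ICot n) (pr1 ∘ (Mixed.natChart hφ).symm) liouville z =
      z.2.1 ∘L .fst ℝ (EMod n) ((EMod n →L[ℝ] ℝ) × Fib n) := by
  have hf : MDifferentiableAt 𝓘(ℝ, PMod n) (ICot n)
      ((pr1 : Mixed n π → CotBundle n E) ∘ (Mixed.natChart hφ).symm) z :=
    (contMDiff_pr1.contMDiffAt.comp z (contMDiffAt_symm_of_mem_maximalAtlas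
      (Mixed.natChart_mem_maximalAtlas hφ) hz)).mdifferentiableAt (by simp)
  rw [pullbackOneForm_liouville hf]
  refine ContinuousLinearMap.ext fun u => ?_
  refine congrArg z.2.1 (.trans ?_ (hφ.toMod_fromMod hz.1 u.1))
  exact congrArg (toMod φ (φ.symm z.1)) (mfderiv_comp_continuousLinearMap
    (.fst ℝ (EMod n) ((EMod n →L[ℝ] ℝ) × Fib n)) (hφ.mdiff.symm.mdifferentiableAt hz.1) u)

theorem canonicalForm_pr1_ofCoord (u w : PMod n) :
    pullbackForm (IP n) (ICot n) pr1 canonicalForm ((Mixed.natChart hφ).symm z)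
      (ofCoord (Mixed.natChart hφ) z u) (ofCoord (Mixed.natChart hφ) z w) =
      w.2.1 u.1 - u.2.1 w.1 := by
  have hc := Mixed.natChart_mem_maximalAtlas hφ
  let T (y : PMod n) : PMod n →L[ℝ] ℝ := y.2.1 ∘L .fst ℝ _ _
  have hT : HasFDerivAt T _ z :=
    (ContinuousLinearMap.fst ℝ (EMod n →L[ℝ] ℝ) (Fib n) ∘L .snd ℝ (EMod n) _).hasFDerivAt.clm_comp
      (hasFDerivAt_const _ z)
  have hpr1 (u : PMod n) := mfderiv_ofCoord hc hz (contMDiff_pr1.mdifferentiableAt (by simp)) u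
  have hcurl := dForm_mfderiv_modelSpace (T := T)
    ((contMDiff_pr1.contMDiffAt.comp z (contMDiffAt_symm_of_mem_maximalAtlas hc hz)).of_le
      ENat.LEInfty.out) (differentiableAt_localRep_liouville _)
    (Filter.mem_of_superset ((Mixed.natChart hφ).open_target.mem_nhds hz)
      fun y hy => pullbackOneForm_pr1_natChart_symm hφ hy) u w
  have hfderiv (u w : PMod n) : fderiv ℝ T z u w = u.2.1 w.1 := by
    rw [hT.fderiv]
    simp
  rw [hfderiv, hfderiv] at hcurl
  change -dForm (ICot n) liouville _ (mfderiv (IP n) (ICot n) pr1 _ _)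
    (mfderiv (IP n) (ICot n) pr1 _ _) = _
  rw [hpr1, hpr1, ← neg_sub]
  exact congrArg Neg.neg hcurl

variable {L : J1 n π → ℝ} (hL : ContMDiff (IJ n) 𝓘(ℝ, ℝ) ∞ L)
include hL

theorem omegaH_ofCoord_cov (u : PMod n) (a : EMod n →L[ℝ] ℝ) :
    omegaH L ((Mixed.natChart hφ).symm z) (ofCoord (Mixed.natChart hφ) z u)
      (ofCoord (Mixed.natChart hφ) z (0, a, 0)) = a (u.1 - u.1.1 • (1, z.2.2)) := by
  change pullbackForm (IP n) (ICot n) pr1 canonicalForm _ _ _ +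
    (mvfderiv (IP n) (energy L) _ _ * eta _ _ - mvfderiv (IP n) (energy L) _ _ * eta _ _) = _
  rw [canonicalForm_pr1_ofCoord hφ hz, mvfderiv_energy_ofCoord hφ hz hL, eta_ofCoord hφ hz,
    eta_ofCoord hφ hz, map_sub, map_smul, smul_eq_mul, Prod.fst_zero, map_zero]
  ring

omit hz in
theorem omegaH_apply_of_mfderiv_pr2_eq_zero {p : Mixed n π} {Z W : TangentSpace (IP n) p}
    (hZ : mfderiv (IJ n) 𝓘(ℝ, EMod n) J1.pt (pr2 p) (mfderiv (IP n) (IJ n) pr2 p Z) =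
      eta p Z • (pr2 p).vel)
    (hW : mfderiv (IP n) (IJ n) pr2 p W = 0) : omegaH L p Z W = 0 := by
  obtain ⟨φ, hφ, z, hz, rfl⟩ := Mixed.exists_natChart_symm_eq p
  have hz' : coordPr2 z ∈ (J1.natChart hφ).target := ⟨hz.1, mem_univ _⟩
  have hsurj := (ofCoord_bijective (Mixed.natChart_mem_maximalAtlas hφ) hz).2
  obtain ⟨u, rfl⟩ := hsurj Z
  obtain ⟨⟨y, a, w⟩, rfl⟩ := hsurj W
  rw [mfderiv_pr2_ofCoord hφ hz] at hW hZ
  have hyw : coordPr2 (y, a, w) = 0 :=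
    (ofCoord_bijective (J1.natChart_mem_maximalAtlas hφ) hz').1 (hW.trans (map_zero _).symm)
  obtain rfl : y = 0 := congrArg Prod.fst hyw
  obtain rfl : w = 0 := congrArg Prod.snd hyw
  have hu : u.1 = u.1.1 • ((1, z.2.2) : EMod n) := by
    have h := ((J1.mfderiv_pt_ofCoord hφ hz' (coordPr2 u)).symm.trans hZ).trans
      (congrArg₂ (· • ·) (eta_ofCoord hφ hz u) (J1.vel_natChart_symm hφ hz'))
    have h' := congrArg (toMod φ (φ.symm z.1)) (h.trans (map_smul (fromMod φ z.1) _ _).symm)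
    exact ((hφ.toMod_fromMod hz.1 _).symm.trans h').trans (hφ.toMod_fromMod hz.1 _)
  rw [omegaH_ofCoord_cov hφ hz hL, sub_eq_zero.2 hu, map_zero]

end MixedBundle

section Legendre
variable {n : ℕ} {E : Type u} [TopologicalSpace E] [ChartedSpace (EMod n) E]
  {π : E → ℝ} [IsFibreBundle n π]

theorem energy_graphMap (L : J1 n π → ℝ) (v : J1 n π) : energy L (graphMap L v) = 0 := by
  change L v * mvfderiv 𝓘(ℝ, EMod n) π v.pt v.vel + mvfderiv (IJ n) L v (vlift v v.vel) - L v = 0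
  rw [v.dt_vel, vlift_vel, map_zero, mul_one, add_zero, sub_self]

variable {L : J1 n π → ℝ} (hL : ContMDiff (IJ n) 𝓘(ℝ, ℝ) ∞ L)
include hL

theorem graphMap_natChart_symm {φ : OpenPartialHomeomorph E (EMod n)} (hφ : IsBundleChart π φ)
    {z : EMod n × Fib n} (hz : z ∈ (J1.natChart hφ).target) :
    graphMap L ((J1.natChart hφ).symm z) = (Mixed.natChart hφ).symm
      (z.1, coordLegendre (L ∘ (J1.natChart hφ).symm) z, z.2) := by
  have hsource : graphMap L ((J1.natChart hφ).symm z) ∈ (Mixed.natChart hφ).source :=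
    (J1.natChart hφ).map_target hz
  rw [(Mixed.natChart hφ).eq_symm_apply hsource ⟨hz.1, mem_univ _⟩]
  have hvel := congrArg Prod.snd ((J1.natChart hφ).right_inv hz)
  refine Prod.ext (φ.right_inv hz.1) (Prod.ext ?_ hvel)
  change legendreCov L ((J1.natChart hφ).symm z) ∘L (toMod φ (φ.symm z.1)).inverse = _
  rw [hφ.toMod_inverse hz.1]
  exact ContinuousLinearMap.ext fun u => legendreCov_fromMod hφ hz hL u

theorem contMDiff_graphMap : ContMDiff (IJ n) (IP n) ∞ (graphMap L) := by
  intro v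
  obtain ⟨φ, hφ, z, hz, rfl⟩ := J1.exists_natChart_symm_eq v
  have hcoord : ContDiffAt ℝ ∞ (fun y : EMod n × Fib n =>
      (y.1, coordLegendre (L ∘ (J1.natChart hφ).symm) y, y.2)) z :=
    contDiffAt_fst.prodMk ((contDiffAt_coordLegendre
      (contDiffAt_comp_natChart_symm hφ hz hL) (by simp)).prodMk contDiffAt_snd)
  have hsymm := contMDiffAt_symm_of_mem_maximalAtlas (Mixed.natChart_mem_maximalAtlas hφ)
    (x := (z.1, coordLegendre (L ∘ (J1.natChart hφ).symm) z, z.2)) ⟨hz.1, mem_univ _⟩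
  exact contMDiffAt_of_comp_chart_symm (J1.natChart_mem_maximalAtlas hφ) hz
    ((hsymm.comp z hcoord.contMDiffAt).congr_of_eventuallyEq (Filter.mem_of_superset
      ((J1.natChart hφ).open_target.mem_nhds hz) fun y hy => graphMap_natChart_symm hL hφ hy))

theorem mfderiv_pr2_graphMap (v : J1 n π) (X : TangentSpace (IJ n) v) :
    mfderiv (IP n) (IJ n) pr2 (graphMap L v) (mfderiv (IJ n) (IP n) (graphMap L) v X) = X := by
  have hid : (pr2 : Mixed n π → J1 n π) ∘ graphMap L = id := rfl
  have h := mfderiv_comp_apply (I'' := IJ n) v (contMDiff_pr2.mdifferentiableAt (by simp))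
    ((contMDiff_graphMap hL).mdifferentiableAt (by simp)) X
  rw [hid, mfderiv_id] at h
  exact h.symm

theorem mvfderiv_energy_graphMap (v : J1 n π) (X : TangentSpace (IJ n) v) :
    mvfderiv (IP n) (energy L) (graphMap L v) (mfderiv (IJ n) (IP n) (graphMap L) v X) = 0 := by
  have h := mfderiv_comp_apply (I'' := 𝓘(ℝ, ℝ)) v
    ((contMDiff_energy hL).mdifferentiableAt (by simp))
    ((contMDiff_graphMap hL).mdifferentiableAt (by simp)) X
  rw [show energy L ∘ graphMap L = fun _ => 0 from funext (energy_graphMap L), mfderiv_const] at h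
  exact h.symm

variable [IsManifold 𝓘(ℝ, EMod n) ∞ E]

theorem eta_graphMap (v : J1 n π) (X : TangentSpace (IJ n) v) :
    eta (graphMap L v) (mfderiv (IJ n) (IP n) (graphMap L) v X) = etaJ v X := by
  rw [eta_apply, mfderiv_pr2_graphMap hL]
  rfl

theorem contMDiff_legendre : ContMDiff (IJ n) (ICot n) ∞ (legendre L) :=
  contMDiff_pr1.comp (contMDiff_graphMap hL)

theorem pullbackOneForm_legendre (v : J1 n π) :
    pullbackOneForm (IJ n) (ICot n) (legendre L) liouville v = poincareCartan L v :=
  (pullbackOneForm_liouville ((contMDiff_legendre hL).mdifferentiableAt (by simp))).trans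
    (ContinuousLinearMap.ext (legendreCov_apply L v))

theorem pullbackForm_legendre (v : J1 n π) :
    pullbackForm (IJ n) (ICot n) (legendre L) canonicalForm v = omegaL L v := by
  have : IsManifold (IJ n) 1 (J1 n π) := IsManifold.of_le (n := ∞) (by simp)
  have h := dForm_pullbackOneForm ((contMDiff_legendre hL).contMDiffAt.of_le ENat.LEInfty.out)
    (differentiableAt_localRep_liouville (legendre L v))
  rw [funext (pullbackOneForm_legendre hL)] at h
  exact congrArg Neg.neg h.symm

theorem pullbackForm_graphMap (v : J1 n π) :
    pullbackForm (IJ n) (IP n) (graphMap L) (omegaH L) v = omegaL L v := by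
  rw [← pullbackForm_legendre hL]
  ext X Y
  have hpr1 (X : TangentSpace (IJ n) v) : mfderiv (IP n) (ICot n) pr1 (graphMap L v)
      (mfderiv (IJ n) (IP n) (graphMap L) v X) = mfderiv (IJ n) (ICot n) (legendre L) v X :=
    (mfderiv_comp_apply (I'' := ICot n) v (contMDiff_pr1.mdifferentiableAt (by simp))
      ((contMDiff_graphMap hL).mdifferentiableAt (by simp)) X).symm
  have hwedge : wedge (IP n) (mvfderiv (IP n) (energy L) (graphMap L v)) (eta (graphMap L v))
      (mfderiv (IJ n) (IP n) (graphMap L) v X) (mfderiv (IJ n) (IP n) (graphMap L) v Y) = 0 := by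
    rw [wedge, LinearMap.mk₂_apply, mvfderiv_energy_graphMap hL, mvfderiv_energy_graphMap hL,
      zero_mul, zero_mul, sub_zero]
  have hcanonical := congrArg₂ (fun ξ ζ => canonicalForm (legendre L v) ξ ζ) (hpr1 X) (hpr1 Y)
  exact (congrArg₂ (· + ·) hcanonical hwedge).trans (add_zero _)

/-- The pointwise form of `IsEulerLagrangeField`: `X ∈ T_v J¹π` satisfies `i_X ω_L = 0` and
`i_X (π_1^* dt) = 1`. -/
def IsEulerLagrangeAt (L : J1 n π → ℝ) (v : J1 n π) (X : TangentSpace (IJ n) v) : Prop :=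
  omegaL L v X = 0 ∧ etaJ v X = 1

section Coordinates
variable {φ : OpenPartialHomeomorph E (EMod n)} (hφ : IsBundleChart π φ)
  {z : EMod n × Fib n} (hz : z ∈ (J1.natChart hφ).target)
include hz

theorem pullbackOneForm_legendre_natChart_symm :
    pullbackOneForm (IJ n) (ICot n) (legendre L ∘ (J1.natChart hφ).symm) liouville z =
      coordLegendre (L ∘ (J1.natChart hφ).symm) z ∘L .fst ℝ (EMod n) (Fib n) := by
  have hf : MDifferentiableAt (IJ n) (ICot n) (legendre L ∘ (J1.natChart hφ).symm) z :=
    ((contMDiff_legendre hL).mdifferentiableAt (by simp)).comp z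
      ((J1.contMDiffAt_natChart_symm hφ hz).mdifferentiableAt (by simp))
  rw [pullbackOneForm_liouville hf]
  refine ContinuousLinearMap.ext fun u => .trans ?_ (legendreCov_fromMod hφ hz hL u.1)
  exact congrArg (legendreCov L ((J1.natChart hφ).symm z)) (mfderiv_comp_continuousLinearMap
    (.fst ℝ (EMod n) (Fib n)) (hφ.mdiff.symm.mdifferentiableAt hz.1) u)

theorem omegaL_ofCoord (u w : EMod n × Fib n) :
    omegaL L ((J1.natChart hφ).symm z) (ofCoord (J1.natChart hφ) z u)
      (ofCoord (J1.natChart hφ) z w) =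
      fderiv ℝ (coordLegendre (L ∘ (J1.natChart hφ).symm)) z w u.1 -
        fderiv ℝ (coordLegendre (L ∘ (J1.natChart hφ).symm)) z u w.1 := by
  set T := coordLegendre (L ∘ (J1.natChart hφ).symm)
  have hT : DifferentiableAt ℝ T z := (contDiffAt_coordLegendre (m := ∞)
    (contDiffAt_comp_natChart_symm hφ hz hL) (by simp)).differentiableAt (by simp)
  have hfderiv (u w : EMod n × Fib n) :
      fderiv ℝ (fun y => T y ∘L .fst ℝ (EMod n) (Fib n)) z u w = fderiv ℝ T z u w.1 := by
    rw [(hT.hasFDerivAt.clm_comp (hasFDerivAt_const _ z)).fderiv]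
    simp
  have hlegendre (u : EMod n × Fib n) := mfderiv_ofCoord (J1.natChart_mem_maximalAtlas hφ) hz
    ((contMDiff_legendre hL).mdifferentiableAt (by simp)) u
  have hcurl := dForm_mfderiv_modelSpace (((contMDiff_legendre hL).contMDiffAt.comp z
    (J1.contMDiffAt_natChart_symm hφ hz)).of_le ENat.LEInfty.out)
    (differentiableAt_localRep_liouville _)
    (Filter.mem_of_superset ((J1.natChart hφ).open_target.mem_nhds hz)
      fun y hy => pullbackOneForm_legendre_natChart_symm hL hφ hy) u w
  rw [hfderiv, hfderiv] at hcurl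
  rw [← pullbackForm_legendre hL]
  change -dForm (ICot n) liouville _ (mfderiv (IJ n) (ICot n) (legendre L) _ _)
    (mfderiv (IJ n) (ICot n) (legendre L) _ _) = _
  rw [hlegendre, hlegendre, ← neg_sub]
  exact congrArg Neg.neg hcurl

theorem isEulerLagrangeAt_ofCoord_iff (hreg : IsRegular L) (u : EMod n × Fib n) :
    IsEulerLagrangeAt L ((J1.natChart hφ).symm z) (ofCoord (J1.natChart hφ) z u) ↔
      u = coordField (L ∘ (J1.natChart hφ).symm) z := by
  rw [← coordLegendre_curl_eq_zero_iff
    ((contDiffAt_comp_natChart_symm hφ hz hL).of_le ENat.LEInfty.out)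
    (velHessian_isInvertible hφ hz hL hreg), IsEulerLagrangeAt, etaJ_ofCoord hφ hz,
    LinearMap.ext_iff]
  have hsurj := (ofCoord_bijective (J1.natChart_mem_maximalAtlas hφ) hz).2
  refine and_congr_left' (hsurj.forall.trans (forall_congr' fun w => ?_))
  rw [omegaL_ofCoord hL hφ hz]
  exact sub_eq_zero.trans (eq_comm.trans sub_eq_zero.symm)

theorem isEulerLagrangeAt_iff (hreg : IsRegular L)
    (X : TangentSpace (IJ n) ((J1.natChart hφ).symm z)) :
    IsEulerLagrangeAt L ((J1.natChart hφ).symm z) X ↔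
      X = ofCoord (J1.natChart hφ) z (coordField (L ∘ (J1.natChart hφ).symm) z) := by
  have hbij := ofCoord_bijective (J1.natChart_mem_maximalAtlas hφ) hz
  obtain ⟨u, rfl⟩ := hbij.2 X
  rw [isEulerLagrangeAt_ofCoord_iff hL hφ hz hreg]
  exact hbij.1.eq_iff.symm

end Coordinates

variable (hreg : IsRegular L)
include hreg

theorem existsUnique_isEulerLagrangeAt (v : J1 n π) :
    ∃! X : TangentSpace (IJ n) v, IsEulerLagrangeAt L v X := by
  obtain ⟨φ, hφ, z, hz, rfl⟩ := J1.exists_natChart_symm_eq v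
  exact ⟨_, (isEulerLagrangeAt_iff hL hφ hz hreg _).2 rfl,
    fun X hX => (isEulerLagrangeAt_iff hL hφ hz hreg X).1 hX⟩

theorem IsEulerLagrangeAt.mfderiv_pt {v : J1 n π} {X : TangentSpace (IJ n) v}
    (hX : IsEulerLagrangeAt L v X) : mfderiv (IJ n) 𝓘(ℝ, EMod n) J1.pt v X = v.vel := by
  obtain ⟨φ, hφ, z, hz, rfl⟩ := J1.exists_natChart_symm_eq v
  rw [(isEulerLagrangeAt_iff hL hφ hz hreg X).1 hX, J1.mfderiv_pt_ofCoord hφ hz,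
    J1.vel_natChart_symm hφ hz]
  rfl

theorem IsEulerLagrangeAt.omegaH_mfderiv_graphMap {v : J1 n π} {X : TangentSpace (IJ n) v}
    (hX : IsEulerLagrangeAt L v X) :
    omegaH L (graphMap L v) (mfderiv (IJ n) (IP n) (graphMap L) v X) = 0 := by
  refine LinearMap.ext fun W => ?_
  set Y : TangentSpace (IJ n) v := mfderiv (IP n) (IJ n) pr2 (graphMap L v) W
  set Z := mfderiv (IJ n) (IP n) (graphMap L) v X
  set TY := mfderiv (IJ n) (IP n) (graphMap L) v Y
  have htangent : omegaH L (graphMap L v) Z TY = 0 := by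
    refine (DFunLike.congr_fun (DFunLike.congr_fun (pullbackForm_graphMap hL v) X) Y).trans ?_
    rw [hX.1]
    rfl
  have hvertical : omegaH L (graphMap L v) Z (W - TY) = 0 := by
    refine omegaH_apply_of_mfderiv_pr2_eq_zero hL ?_ ?_
    · rw [mfderiv_pr2_graphMap hL, eta_graphMap hL, hX.2, one_smul]
      exact hX.mfderiv_pt hL hreg
    · rw [map_sub, mfderiv_pr2_graphMap hL]
      exact sub_self _
  rw [map_sub, htangent, sub_zero] at hvertical
  exact hvertical

theorem omegaH_mfderiv_graphMap_eq_zero_iff {v : J1 n π} {X : TangentSpace (IJ n) v} :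
    (omegaH L (graphMap L v) (mfderiv (IJ n) (IP n) (graphMap L) v X) = 0 ∧
      eta (graphMap L v) (mfderiv (IJ n) (IP n) (graphMap L) v X) = 1) ↔
      IsEulerLagrangeAt L v X := by
  rw [eta_graphMap hL]
  refine ⟨fun ⟨h, hη⟩ => ⟨?_, hη⟩, fun hX => ⟨hX.omegaH_mfderiv_graphMap hL hreg, hX.2⟩⟩
  ext Y
  rw [← pullbackForm_graphMap hL]
  exact DFunLike.congr_fun h _

end Legendre

section Fields
variable {n : ℕ} {E : Type u} [TopologicalSpace E] [ChartedSpace (EMod n) E]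
  [IsManifold 𝓘(ℝ, EMod n) ∞ E] {π : E → ℝ} [IsFibreBundle n π]
  {L : J1 n π → ℝ} (hL : ContMDiff (IJ n) 𝓘(ℝ, ℝ) ∞ L) (hreg : IsRegular L)
include hL hreg

theorem existsUnique_isEulerLagrangeField :
    ∃! X : ∀ v : J1 n π, TangentSpace (IJ n) v, IsEulerLagrangeField L X := by
  choose X hX hunique using existsUnique_isEulerLagrangeAt hL hreg
  exact ⟨X, ⟨fun v => (hX v).1, fun v => (hX v).2⟩,
    fun Y hY => funext fun v => hunique v _ ⟨hY.omegaL_eq v, hY.eta_eq v⟩⟩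

theorem IsEulerLagrangeField.isSmoothField {X : ∀ v : J1 n π, TangentSpace (IJ n) v}
    (hX : IsEulerLagrangeField L X) : IsSmoothField X := by
  have : IsManifold (IJ n) 1 (J1 n π) := IsManifold.of_le (n := ∞) (by simp)
  intro v
  obtain ⟨φ, hφ, z, hz, rfl⟩ := J1.exists_natChart_symm_eq v
  exact contMDiffAt_vectorField_of_ofCoord (J1.natChart_mem_maximalAtlas hφ) hz
    (contDiffAt_coordField (contDiffAt_comp_natChart_symm hφ hz hL)
      (velHessian_isInvertible hφ hz hL hreg))
    fun y hy => (isEulerLagrangeAt_iff hL hφ hy hreg _).1 ⟨hX.omegaL_eq _, hX.eta_eq _⟩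

theorem IsSRSolution.eq_mfderiv_graphMap {X : ∀ v : J1 n π, TangentSpace (IJ n) v}
    {Z : ∀ p : graphL L, TangentSpace (IP n) p.1} (hZ : IsSRSolution L Z)
    (hX : IsEulerLagrangeField L X) (v : J1 n π) :
    Z ⟨graphMap L v, v, rfl⟩ = mfderiv (IJ n) (IP n) (graphMap L) v (X v) := by
  obtain ⟨Y, hY⟩ := hZ.tangent v
  have hω := hZ.omegaH_eq ⟨graphMap L v, v, rfl⟩
  have hη := hZ.eta_eq ⟨graphMap L v, v, rfl⟩
  rw [← hY] at hω hη ⊢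
  exact congrArg _ ((existsUnique_isEulerLagrangeAt hL hreg v).unique
    ((omegaH_mfderiv_graphMap_eq_zero_iff hL hreg).1 ⟨hω, hη⟩) ⟨hX.omegaL_eq v, hX.eta_eq v⟩)

theorem existsUnique_isSRSolution :
    ∃! Z : ∀ p : graphL L, TangentSpace (IP n) p.1, IsSRSolution L Z := by
  obtain ⟨X, hX, -⟩ := existsUnique_isEulerLagrangeField hL hreg
  have hZ (v : J1 n π) := (omegaH_mfderiv_graphMap_eq_zero_iff hL hreg).2
    ⟨hX.omegaL_eq v, hX.eta_eq v⟩
  let Z (p : graphL L) : PMod n := mfderiv (IJ n) (IP n) (graphMap L) (pr2 p.1) (X (pr2 p.1))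
  refine ⟨Z, ⟨?_, ?_, fun v => ⟨X v, rfl⟩⟩, fun Z' hZ' => ?_⟩
  · rintro ⟨_, v, rfl⟩
    exact (hZ v).1
  · rintro ⟨_, v, rfl⟩
    exact (hZ v).2
  · funext ⟨_, v, hv⟩
    subst hv
    exact hZ'.eq_mfderiv_graphMap hL hreg hX v

theorem IsSRSolution.isSmoothAlong {Z : ∀ p : graphL L, TangentSpace (IP n) p.1}
    (hZ : IsSRSolution L Z) : IsSmoothAlong L Z := by
  have : IsManifold (IJ n) 1 (J1 n π) := IsManifold.of_le (n := ∞) (by simp)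
  have : IsManifold (IP n) 1 (Mixed n π) := IsManifold.of_le (n := ∞) (by simp)
  obtain ⟨X, hX, -⟩ := existsUnique_isEulerLagrangeField hL hreg
  have hsmooth := ((contMDiff_graphMap hL).contMDiff_tangentMap (m := ∞) (by simp)).comp
    (hX.isSmoothField hL hreg)
  refine hsmooth.congr fun v => ?_
  rw [hZ.eq_mfderiv_graphMap hL hreg hX]
  rfl

end Fields

end SkinnerRusk
end

theorem mainTheorem1 {n : ℕ} {E : Type*} [TopologicalSpace E] [ChartedSpace (SkinnerRusk.EMod n) E]
    [IsManifold 𝓘(ℝ, SkinnerRusk.EMod n) ∞ E] (π : E → ℝ) [SkinnerRusk.IsFibreBundle n π]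
    (L : SkinnerRusk.J1 n π → ℝ) (hL : ContMDiff (SkinnerRusk.IJ n) 𝓘(ℝ, ℝ) ∞ L)
    (hreg : SkinnerRusk.IsRegular L) :
    (∃! X : ∀ v : SkinnerRusk.J1 n π, TangentSpace (SkinnerRusk.IJ n) v,
      SkinnerRusk.IsEulerLagrangeField L X) ∧
    (∃! Z : ∀ p : SkinnerRusk.graphL L, TangentSpace (SkinnerRusk.IP n) p.1,
      SkinnerRusk.IsSRSolution L Z) ∧
    ∀ X Z, SkinnerRusk.IsEulerLagrangeField L X → SkinnerRusk.IsSRSolution L Z →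
      SkinnerRusk.IsSmoothField X ∧ SkinnerRusk.IsSmoothAlong L Z ∧
      ∀ v : SkinnerRusk.J1 n π, Z ⟨SkinnerRusk.graphMap L v, v, rfl⟩ =
        mfderiv (SkinnerRusk.IJ n) (SkinnerRusk.IP n) (SkinnerRusk.graphMap L) v (X v) :=
  ⟨SkinnerRusk.existsUnique_isEulerLagrangeField hL hreg,
    SkinnerRusk.existsUnique_isSRSolution hL hreg,
    fun _ _ hX hZ => ⟨hX.isSmoothField hL hreg, hZ.isSmoothAlong hL hreg,
      hZ.eq_mfderiv_graphMap hL hreg hX⟩⟩
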